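/- Let $K$ be an algebraically closed field of characteristic $0$ (for instance $K=\overline{k}$, where $E$ is defined over a field $k$ of characteristic $0$), let $E$ be an elliptic curve over $K$ with identity $\mathcal{O}$, and let $n\ge 2$ and $N\ge 1$ be integers. For $T\in E(K)$ write $\tau_T:P\mapsto P+T$ for translation by $T$, and for $m \ge 0$ let $\mathcal{L}(m.\mathcal{O})$ be the Riemann–Roch space of rational functions on $E$ that are regular away from $\mathcal{O}$ and have a pole of order at most $m$ at $\mathcal{O}$. Let $$\Theta_n=\{(f,T)\in K(E)^\times\times E[n](K)\;:\;\operatorname{div}(f)=\tau_T^*(n.\mathcal{O})-n.\mathcal{O}\}$$ be the theta group, with group law $(f,S)*(g,T)=((\tau_T^*f)g,S+T)$. For each $M\ge 0$ it acts on $\mathcal{L}(nM.\mathcal{O})$ by $$(f,T):h\mapsto\tau_{-T}^*(h/f^M).$$ Let $V_n=\mathcal{L}(n.\mathcal{O})^*$ with the contragredient of the action for $M=1$, and let the Heisenberg group $H_n\subset\Theta_n$ consist of the elements that act on $V_n$ with determinant $1$. Let $g\in K(E)^\times$ be a rational function with $\operatorname{div}(g)=[n]^*\mathcal{O}-n^2.\mathcal{O}$,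 where $[n]^*\mathcal{O}$ is the pull-back of the divisor $\mathcal{O}$ under the multiplication-by-$n$ map $[n]:E\to E$. Then $g^N$ lies in $\mathcal{L}(n^2N.\mathcal{O})$ and is fixed by the action of $H_n$ on this space: for all $(f,T)\in H_n$, $$\tau_{-T}^*\bigl(g^N/f^{nN}\bigr)=g^N.$$ -/

import Mathlib

open WeierstrassCurve Polynomial
open scoped nonZeroDivisors WithZero WeierstrassCurve.Affine Polynomial.Bivariate

noncomputable section

namespace EllipticTheta

universe u

variable {K : Type u} [Field K] (W : Affine K)

/-! ### The affine coordinate ring of an elliptic curve is a Dedekind domain -/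

instance isNoetherianRing_coordinateRing : IsNoetherianRing W.CoordinateRing :=
  inferInstanceAs (IsNoetherianRing (K[X][Y] ⧸ Ideal.span {W.polynomial}))

instance finite_coordinateRing : Module.Finite K[X] W.CoordinateRing :=
  .of_basis (Affine.CoordinateRing.basis W)

instance finiteType_coordinateRing : Algebra.FiniteType K W.CoordinateRing :=
  Algebra.FiniteType.trans (S := K[X]) inferInstance inferInstance

theorem XYIdeal_isMaximal {x y : K} (h : W.Nonsingular x y) :
    (Affine.CoordinateRing.XYIdeal W x (C y)).IsMaximal := by
  have e := Affine.CoordinateRing.quotientXYIdealEquiv (W' := W) (x := x) (y := C y) h.1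
  exact Ideal.Quotient.maximal_of_isField _
    (MulEquiv.isField (Field.toIsField K) e.toMulEquiv)

theorem XYIdeal_ne_bot {x y : K} : Affine.CoordinateRing.XYIdeal W x (C y) ≠ ⊥ := by
  intro h
  refine Affine.CoordinateRing.XClass_ne_zero (W' := W) x ?_
  rw [← Ideal.mem_bot, ← h]
  exact Ideal.subset_span (Set.mem_insert _ _)

/-- Over an algebraically closed field, the maximal ideals of the coordinate ring are the ideals
of the affine points. -/
theorem exists_eq_XYIdeal [W.IsElliptic] [IsAlgClosed K] (M : Ideal W.CoordinateRing)
    [hM : M.IsMaximal] :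
    ∃ (x y : K) (_ : W.Nonsingular x y), M = Affine.CoordinateRing.XYIdeal W x (C y) := by
  let := Ideal.Quotient.field M
  have : Algebra.FiniteType K (W.CoordinateRing ⧸ M) := inferInstance
  have : Module.Finite K (W.CoordinateRing ⧸ M) := finite_of_finite_type_of_isJacobsonRing _ _
  have hb : Function.Bijective (algebraMap K (W.CoordinateRing ⧸ M)) :=
    IsAlgClosed.algebraMap_bijective_of_isIntegral
  let q : W.CoordinateRing →+* W.CoordinateRing ⧸ M := Ideal.Quotient.mk M
  obtain ⟨x, hx⟩ := hb.2 (q (algebraMap K[X] W.CoordinateRing X))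
  obtain ⟨y, hy⟩ := hb.2 (q (AdjoinRoot.root W.polynomial))
  have hcomp : q.comp (Affine.CoordinateRing.mk W) =
      (algebraMap K (W.CoordinateRing ⧸ M)).comp (Polynomial.evalEvalRingHom x y) := by
    refine Polynomial.ringHom_ext' (Polynomial.ringHom_ext (fun a => ?_) ?_) ?_
    · simp only [RingHom.comp_apply, coe_evalRingHom, eval_C]
      rfl
    · simp only [RingHom.comp_apply, coe_evalRingHom, eval_C, eval_X]
      exact hx.symm
    · simp only [RingHom.comp_apply, coe_evalRingHom, eval_C, eval_X]
      exact hy.symm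
  have hev (p : K[X][Y]) : q (Affine.CoordinateRing.mk W p) =
      algebraMap K (W.CoordinateRing ⧸ M) (p.evalEval x y) := RingHom.congr_fun hcomp p
  have heq : W.Equation x y := by
    apply hb.1
    rw [← hev, map_zero, Affine.CoordinateRing.mk, AdjoinRoot.mk_self, map_zero]
  have hns : W.Nonsingular x y := Affine.equation_iff_nonsingular.mp heq
  refine ⟨x, y, hns, ((XYIdeal_isMaximal W hns).eq_of_le hM.ne_top ?_).symm⟩
  rw [Affine.CoordinateRing.XYIdeal, Ideal.span_le]
  rintro _ (rfl | rfl)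
  · refine Ideal.Quotient.eq_zero_iff_mem.mp ((hev _).trans ?_)
    simp [evalEval_C]
  · refine Ideal.Quotient.eq_zero_iff_mem.mp ((hev _).trans ?_)
    simp

theorem isUnit_coeIdeal [W.IsElliptic] [IsAlgClosed K] (I : Ideal W.CoordinateRing) (hI : I ≠ ⊥) :
    IsUnit (I : FractionalIdeal W.CoordinateRing⁰ W.FunctionField) := by
  induction I using IsNoetherian.induction with
  | hgt I ih =>
  by_cases htop : I = ⊤
  · rw [htop, FractionalIdeal.coeIdeal_top]
    exact isUnit_one
  obtain ⟨M, hM, hIM⟩ := Ideal.exists_le_maximal I htop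
  obtain ⟨x, y, h, hMe⟩ := exists_eq_XYIdeal W M
  set u := Affine.CoordinateRing.XYIdeal' h with hu
  have huM : (u : FractionalIdeal W.CoordinateRing⁰ W.FunctionField) = M := by
    rw [hMe, hu]
    exact Affine.CoordinateRing.XYIdeal'_eq h
  have hle : (I : FractionalIdeal W.CoordinateRing⁰ W.FunctionField) * (u⁻¹ : _ˣ) ≤ 1 := by
    calc (I : FractionalIdeal W.CoordinateRing⁰ W.FunctionField) * (u⁻¹ : _ˣ)
        ≤ M * (u⁻¹ : _ˣ) := by
          gcongr
      _ = 1 := by rw [← huM, Units.mul_inv]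
  obtain ⟨J, hJ⟩ := FractionalIdeal.le_one_iff_exists_coeIdeal.mp hle
  have hIJ : (I : FractionalIdeal W.CoordinateRing⁰ W.FunctionField) = J * M := by
    rw [hJ, ← huM, mul_assoc, Units.inv_mul, mul_one]
  have hIJ' : I = J * M := by
    rw [← FractionalIdeal.coeIdeal_mul] at hIJ
    exact FractionalIdeal.coeIdeal_injective hIJ
  have hlt : I < J := by
    refine lt_of_le_of_ne (hIJ'.le.trans Ideal.mul_le_left) fun hEq => ?_
    rw [← hEq, mul_comm] at hIJ'
    obtain ⟨r, hr, hr0⟩ := Submodule.exists_sub_one_mem_and_smul_eq_zero_of_fg_of_le_smul M I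
      (IsNoetherian.noetherian I) (le_of_eq hIJ')
    obtain ⟨a, haI, ha⟩ := Submodule.exists_mem_ne_zero_of_ne_bot hI
    have : r = 0 := (mul_eq_zero.mp (hr0 a haI)).resolve_right ha
    rw [this, zero_sub, neg_mem_iff] at hr
    exact hM.ne_top ((Ideal.eq_top_iff_one _).mpr hr)
  rw [hIJ]
  exact (ih J hlt (ne_bot_of_gt hlt)).mul (huM ▸ u.isUnit)

instance isDedekindDomain_coordinateRing [W.IsElliptic] [IsAlgClosed K] :
    IsDedekindDomain W.CoordinateRing := by
  rw [isDedekindDomain_iff_mul_inv_cancel (K := W.FunctionField)]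
  intro I hI
  obtain ⟨a, J, ha, rfl⟩ := FractionalIdeal.exists_eq_spanSingleton_mul I
  rw [FractionalIdeal.mul_inv_cancel_iff_isUnit]
  refine IsUnit.mul ?_ (isUnit_coeIdeal W J ?_)
  · have ha' : algebraMap W.CoordinateRing W.FunctionField a ≠ 0 :=
      (map_ne_zero_iff _ (IsFractionRing.injective _ _)).mpr ha
    refine IsUnit.of_mul_eq_one
      (FractionalIdeal.spanSingleton _ (algebraMap W.CoordinateRing W.FunctionField a)) ?_
    rw [FractionalIdeal.spanSingleton_mul_spanSingleton, inv_mul_cancel₀ ha',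
      FractionalIdeal.spanSingleton_one]
  · rintro rfl
    simp at hI

/-! ### Points of the curve as places of the function field -/

theorem norm_ne_zero {a : W.CoordinateRing} (ha : a ≠ 0) : Algebra.norm K[X] a ≠ 0 :=
  (Algebra.norm_ne_zero_iff_of_basis (Affine.CoordinateRing.basis W)).mpr ha

/-- The order of the pole at the point at infinity of a non-zero element of the coordinate ring.
For `a = p(x) + q(x) y` this is `max (2 deg p) (2 deg q + 3)`. -/
def poleOrder (a : W.CoordinateRing) : ℕ := (Algebra.norm K[X] a).natDegree

theorem poleOrder_add_le {a b : W.CoordinateRing} :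
    poleOrder W (a + b) ≤ max (poleOrder W a) (poleOrder W b) := by
  obtain ⟨p, q, rfl⟩ := Affine.CoordinateRing.exists_smul_basis_eq a
  obtain ⟨r, s, rfl⟩ := Affine.CoordinateRing.exists_smul_basis_eq b
  have hadd : p • (1 : W.CoordinateRing) + q • Affine.CoordinateRing.mk W Y +
      (r • (1 : W.CoordinateRing) + s • Affine.CoordinateRing.mk W Y) =
      (p + r) • (1 : W.CoordinateRing) + (q + s) • Affine.CoordinateRing.mk W Y := by
    rw [add_smul, add_smul]
    abel
  have hmono : Monotone fun d : WithBot ℕ => 2 • d := fun _ _ h => nsmul_le_nsmul_right h 2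
  have h1 : 2 • (p + r).degree ≤ max (2 • p.degree) (2 • r.degree) :=
    (hmono (degree_add_le p r)).trans_eq hmono.map_max
  have h2 : 2 • (q + s).degree + 3 ≤ max (2 • q.degree + 3) (2 • s.degree + 3) := by
    rw [max_add_add_right]
    exact add_le_add_left ((hmono (degree_add_le q s)).trans_eq hmono.map_max) 3
  rw [hadd, le_max_iff]
  have hdeg : (Algebra.norm K[X] ((p + r) • (1 : W.CoordinateRing) +
      (q + s) • Affine.CoordinateRing.mk W Y)).degree ≤
      max (Algebra.norm K[X] (p • (1 : W.CoordinateRing) +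
        q • Affine.CoordinateRing.mk W Y)).degree
        (Algebra.norm K[X] (r • (1 : W.CoordinateRing) +
        s • Affine.CoordinateRing.mk W Y)).degree := by
    simp only [Affine.CoordinateRing.degree_norm_smul_basis]
    refine max_le (h1.trans ?_) (h2.trans ?_)
    · exact max_le_max (le_max_left _ _) (le_max_left _ _)
    · exact max_le_max (le_max_right _ _) (le_max_right _ _)
  exact (le_max_iff.mp hdeg).imp natDegree_le_natDegree natDegree_le_natDegree

/-- The valuation at the point at infinity, on the coordinate ring. -/
def infinityValuation : Valuation W.CoordinateRing ℤᵐ⁰ := by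
  classical
  exact
  { toFun := fun a => if a = 0 then 0 else WithZero.exp (poleOrder W a : ℤ)
    map_zero' := if_pos rfl
    map_one' := by simp [poleOrder]
    map_mul' := fun a b => by
      by_cases ha : a = 0
      · simp [ha]
      by_cases hb : b = 0
      · simp [hb]
      simp only [ha, hb, mul_eq_zero, or_self, if_false, poleOrder, map_mul]
      rw [natDegree_mul (norm_ne_zero W ha) (norm_ne_zero W hb), Nat.cast_add, WithZero.exp_add]
    map_add_le_max' := fun a b => by
      by_cases ha : a = 0
      · simp [ha]
      by_cases hb : b = 0
      · simp [hb]
      by_cases hab : a + b = 0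
      · simp [hab]
      simp only [ha, hb, hab, if_false, le_max_iff, WithZero.exp_le_exp, Nat.cast_le]
      exact le_max_iff.mp (poleOrder_add_le W) }

theorem infinityValuation_supp :
    W.CoordinateRing⁰ ≤ (infinityValuation W).supp.primeCompl := by
  intro a ha h
  have ha' : a ≠ 0 := nonZeroDivisors.ne_zero ha
  have h' : infinityValuation W a = 0 := h
  simp [infinityValuation, ha'] at h'

variable [W.IsElliptic] [IsAlgClosed K]

/-- The prime ideal of the coordinate ring at an affine point. -/
def affinePlace {x y : K} (h : W.Nonsingular x y) :
    IsDedekindDomain.HeightOneSpectrum W.CoordinateRing where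
  asIdeal := Affine.CoordinateRing.XYIdeal W x (C y)
  isPrime := (XYIdeal_isMaximal W h).isPrime
  ne_bot := XYIdeal_ne_bot W

/-- The normalised (multiplicatively written) valuation of the function field at a point. -/
def valuationAt : W.Point → Valuation W.FunctionField ℤᵐ⁰
  | .zero => (infinityValuation W).extendToLocalization (infinityValuation_supp W) W.FunctionField
  | .some _ _ h => (affinePlace W h).valuation W.FunctionField

/-- The order of vanishing `ord_P(f)` of a non-zero rational function `f` at the point `P`. -/
def ord (P : W.Point) (f : W.FunctionField) : ℤ := -WithZero.log (valuationAt W P f)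

theorem valuationAt_algebraMap_le_one (P : W.Point) (c : K) :
    valuationAt W P (algebraMap K W.FunctionField c) ≤ 1 := by
  rw [IsScalarTower.algebraMap_apply K W.CoordinateRing W.FunctionField]
  match P with
  | .zero =>
    rw [valuationAt, Valuation.extendToLocalization_apply_map_apply]
    have h : poleOrder W (algebraMap K W.CoordinateRing c) = 0 := by
      rw [poleOrder, IsScalarTower.algebraMap_apply K K[X] W.CoordinateRing,
        Algebra.norm_algebraMap_of_basis (Affine.CoordinateRing.basis W)]
      simp
    simp only [infinityValuation, Valuation.coe_mk, MonoidWithZeroHom.coe_mk, ZeroHom.coe_mk, h]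
    split_ifs <;> simp
  | .some _ _ h => exact (affinePlace W h).valuation_le_one _

/-- The Riemann-Roch space `L(m.O)`: the rational functions that are regular at all affine points
and have a pole of order at most `m` at the point at infinity `O`. -/
def riemannRoch (m : ℕ) : Submodule K W.FunctionField where
  carrier := {f | (∀ P : W.Point, P ≠ 0 → valuationAt W P f ≤ 1) ∧
    valuationAt W 0 f ≤ WithZero.exp (m : ℤ)}
  zero_mem' := by simp
  add_mem' := fun {f g} hf hg =>
    ⟨fun P hP => (Valuation.map_add _ f g).trans (max_le (hf.1 P hP) (hg.1 P hP)),
      (Valuation.map_add _ f g).trans (max_le hf.2 hg.2)⟩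
  smul_mem' := fun c f hf => by
    have hc (P : W.Point) : valuationAt W P (c • f) ≤ valuationAt W P f := by
      rw [Algebra.smul_def, map_mul]
      exact mul_le_of_le_one_left' (valuationAt_algebraMap_le_one W P c)
    exact ⟨fun P hP => (hc P).trans (hf.1 P hP), (hc 0).trans hf.2⟩

/-! ### Translations -/

instance decidableEqFunctionField : DecidableEq W.FunctionField := Classical.decEq _

instance isElliptic_baseChange : WeierstrassCurve.IsElliptic (W⁄W.FunctionField) :=
  inferInstanceAs (WeierstrassCurve.map W (algebraMap K W.FunctionField)).IsElliptic

variable [DecidableEq K]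

/-- The inclusion of `E(K)` into the group of points of `E` over the function field `K(E)`
(a point of `E` over `K(E)` is a rational map from `E` to itself, and the points of `E(K)` are the
constant maps). -/
def constPoint : W.Point →+ (W⁄W.FunctionField).Point :=
  Affine.Point.baseChange (W' := W) K W.FunctionField

/-- The coordinate function `x`. -/
def xFun : W.FunctionField :=
  algebraMap W.CoordinateRing W.FunctionField (Affine.CoordinateRing.mk W (C X))

/-- The coordinate function `y`. -/
def yFun : W.FunctionField :=
  algebraMap W.CoordinateRing W.FunctionField (Affine.CoordinateRing.mk W Y)

theorem aeval_eq_evalEval (a b : W.FunctionField) :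
    W.polynomial.eval₂ (aeval a : K[X] →ₐ[K] W.FunctionField).toRingHom b =
      (W⁄W.FunctionField).polynomial.evalEval a b := by
  simp [Affine.polynomial, evalEval, eval₂_pow]

theorem equation_xFun_yFun : (W⁄W.FunctionField).Equation (xFun W) (yFun W) := by
  have hr : (aeval (xFun W) : K[X] →ₐ[K] W.FunctionField).toRingHom =
      (algebraMap W.CoordinateRing W.FunctionField).comp (algebraMap K[X] W.CoordinateRing) := by
    refine Polynomial.ringHom_ext (fun c => ?_) ?_
    · simp only [AlgHom.toRingHom_eq_coe, RingHom.coe_coe, aeval_C, RingHom.comp_apply]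
      rfl
    · simp only [AlgHom.toRingHom_eq_coe, RingHom.coe_coe, aeval_X, RingHom.comp_apply]
      rfl
  rw [Affine.Equation, ← aeval_eq_evalEval, hr, yFun, ← Polynomial.hom_eval₂]
  exact (congrArg (algebraMap W.CoordinateRing W.FunctionField)
    (AdjoinRoot.eval₂_root W.polynomial)).trans (map_zero _)

/-- The generic point `(x, y)` of `E`, a point of `E` over `K(E)`. -/
def genericPoint : (W⁄W.FunctionField).Point :=
  .some _ _ (Affine.equation_iff_nonsingular.mp (equation_xFun_yFun W))

theorem xFun_ne_algebraMap (c : K) : xFun W ≠ algebraMap K W.FunctionField c := by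
  intro h
  refine Affine.CoordinateRing.XClass_ne_zero (W' := W) c ?_
  apply IsFractionRing.injective W.CoordinateRing W.FunctionField
  rw [map_zero, Affine.CoordinateRing.XClass, C_sub, map_sub, map_sub, sub_eq_zero]
  exact h

theorem genericPoint_notMem_range : genericPoint W ∉ Set.range (constPoint W) := by
  rintro ⟨P, hP⟩
  match P, hP with
  | .zero, h => exact absurd h (by rintro ⟨⟩)
  | .some x y _, h => exact xFun_ne_algebraMap W x (Affine.Point.some.inj h).1.symm

theorem genericPoint_add_notMem_range (T : W.Point) :
    genericPoint W + constPoint W T ∉ Set.range (constPoint W) := by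
  rintro ⟨P, hP⟩
  exact genericPoint_notMem_range W ⟨P - T, by rw [map_sub, hP, add_sub_cancel_right]⟩

theorem exists_algebraMap_eq {z : W.FunctionField} (hz : IsAlgebraic K z) :
    ∃ c : K, algebraMap K W.FunctionField c = z := by
  have hi := hz.isIntegral
  have h1 : (minpoly K z).degree = 1 :=
    IsAlgClosed.degree_eq_one_of_irreducible K (minpoly.irreducible hi)
  exact minpoly.mem_range_of_degree_eq_one K z h1

/-- A non-constant point of `E` over `K(E)`, i.e. a non-constant rational map `E → E`, induces an
endomorphism (the pull-back) of the function field. -/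
theorem exists_comorphism {Q : (W⁄W.FunctionField).Point} (hQ : Q ∉ Set.range (constPoint W)) :
    ∃ φ : W.FunctionField →ₐ[K] W.FunctionField,
      Affine.Point.map (W' := W) φ (genericPoint W) = Q := by
  match Q, hQ with
  | .zero, hQ => exact absurd ⟨0, rfl⟩ hQ
  | .some a b h, hQ =>
    have hroot : W.polynomial.eval₂ (aeval a : K[X] →ₐ[K] W.FunctionField).toRingHom b = 0 :=
      (aeval_eq_evalEval W a b).trans h.1
    let g : W.CoordinateRing →+* W.FunctionField := AdjoinRoot.lift _ b hroot
    have hgX (p : K[X]) : g (algebraMap K[X] W.CoordinateRing p) = aeval a p :=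
      AdjoinRoot.lift_of hroot
    have hgC (c : K) : g (algebraMap K W.CoordinateRing c) = algebraMap K W.FunctionField c := by
      rw [IsScalarTower.algebraMap_apply K K[X] W.CoordinateRing, hgX]
      exact aeval_C a c
    let f : W.CoordinateRing →ₐ[K] W.FunctionField := { g with commutes' := hgC }
    have hinj : Function.Injective f := by
      rw [injective_iff_map_eq_zero]
      intro z hz
      by_contra hz0
      have hdvd : z ∣ algebraMap K[X] W.CoordinateRing (Algebra.norm K[X] z) := by
        obtain ⟨p, q, rfl⟩ := Affine.CoordinateRing.exists_smul_basis_eq z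
        refine ⟨Affine.CoordinateRing.mk W
          (C p + C q * (-(Y : K[X][Y]) - C (C W.a₁ * X + C W.a₃))), ?_⟩
        refine (Affine.CoordinateRing.coe_norm_smul_basis p q).trans ?_
        rw [map_mul]
        congr 1
        rw [Affine.CoordinateRing.smul, Affine.CoordinateRing.smul, mul_one, map_add, map_mul]
      obtain ⟨w, hw⟩ := hdvd
      have ha : aeval a (Algebra.norm K[X] z) = 0 := by
        rw [← hgX, hw, map_mul]
        exact mul_eq_zero_of_left hz _
      obtain ⟨a₀, rfl⟩ := exists_algebraMap_eq W ⟨_, norm_ne_zero W hz0, ha⟩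
      have hb : IsAlgebraic K b := by
        refine ⟨W.polynomial.map (evalRingHom a₀), (Affine.monic_polynomial.map _).ne_zero, ?_⟩
        rw [aeval_def, eval₂_map, ← hroot]
        congr 1
        refine Polynomial.ringHom_ext (fun c => ?_) ?_ <;> simp
      obtain ⟨b₀, rfl⟩ := exists_algebraMap_eq W hb
      have h₀ : W.Nonsingular a₀ b₀ := (W.map_nonsingular (algebraMap K W.FunctionField).injective
        a₀ b₀).mp h
      exact hQ ⟨.some a₀ b₀ h₀, rfl⟩
    have hlift (z : W.CoordinateRing) :
        (IsFractionRing.liftAlgHom hinj : W.FunctionField →ₐ[K] W.FunctionField)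
          (algebraMap W.CoordinateRing W.FunctionField z) = g z :=
      IsFractionRing.lift_algebraMap hinj z
    refine ⟨IsFractionRing.liftAlgHom hinj, ?_⟩
    rw [genericPoint, Affine.Point.map_some, Affine.Point.some.injEq]
    constructor
    · exact (hlift _).trans ((hgX X).trans (aeval_X a))
    · exact (hlift _).trans (AdjoinRoot.lift_root hroot)

/-- The translation `τ_T^* f`, `(τ_T^* f)(P) = f(P + T)`, of a rational function: the
endomorphism of the function field that carries the generic point `η` to `η + T`. -/
def translate (T : W.Point) : W.FunctionField →ₐ[K] W.FunctionField :=
  (exists_comorphism W (genericPoint_add_notMem_range W T)).choose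

theorem map_translate_genericPoint (T : W.Point) :
    Affine.Point.map (W' := W) (translate W T) (genericPoint W) =
      genericPoint W + constPoint W T :=
  (exists_comorphism W (genericPoint_add_notMem_range W T)).choose_spec

/-! ### Divisors -/

/-- The divisor of a non-zero rational function, as the function `P ↦ ord_P(f)` giving the
coefficient of each point. -/
def divisor (f : W.FunctionField) : W.Point → ℤ := fun P => ord W P f

/-- The divisor `m.O`. -/
def multO (m : ℤ) : W.Point → ℤ := Pi.single 0 m

/-- The pull-back `τ_T^* D` of a divisor under translation by `T`. -/
def translateDivisor (T : W.Point) (D : W.Point → ℤ) : W.Point → ℤ := fun P => D (P + T)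

/-- The local parameter `x / y` at `O`, evaluated at a point of `E` over `K(E)`; i.e. for a rational
map `E → E`, the pull-back of the local parameter under it. -/
def localParameter : (W⁄W.FunctionField).Point → W.FunctionField
  | .zero => 0
  | .some a b _ => a / b

/-- The pull-back divisor `[n]^* O` of the point `O` under multiplication by `n`. A point `P` with
`nP = O` occurs with the ramification index of `[n]` at `P`, i.e. the order of vanishing at `P` of
the pull-back under `[n]` of a local parameter at `O`; here the map `[n]` is the multiple `nη` of
the generic point `η`. -/
def mulPullback (n : ℕ) : W.Point → ℤ := fun P =>
  if n • P = 0 then ord W P (localParameter W (n • genericPoint W)) else 0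

/-! ### The theta group and the Heisenberg group -/

/-- The theta group `Θ_n` of pairs `(f, T)` with `T ∈ E[n]` and `div f = τ_T^*(n.O) - n.O`,
(with group law `(f, S) * (g, T) = ((τ_T^* f) g, S + T)`). -/
def thetaGroup (n : ℕ) : Set (W.FunctionFieldˣ × W.Point) :=
  {p | n • p.2 = 0 ∧
    divisor W (p.1 : W.FunctionField) = translateDivisor W p.2 (multO W n) - multO W n}

/-- The action of `(f, T) ∈ Θ_n` on `L(nN.O)`, given by `h ↦ τ_{-T}^*(h / f^N)`. -/
def thetaAct (N : ℕ) (p : W.FunctionFieldˣ × W.Point) (h : W.FunctionField) : W.FunctionField :=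
  translate W (-p.2) (h / (p.1 : W.FunctionField) ^ N)

/-- The space `V_n = L(n.O)^*`. -/
abbrev V (n : ℕ) : Type u := Module.Dual K (riemannRoch W n)

/-- The linear map `M` is the automorphism of `V_n = L(n.O)^*` defined by `(f, T) ∈ Θ_n`, that is,
the contragredient of the action `h ↦ τ_{-T}^*(h / f)` on `L(n.O)`: the transpose of the inverse map
`h ↦ f · τ_T^* h` of `L(n.O)`. It carries evaluation at a point `P` to `f(P)` times evaluation at
`P + T`. -/
def IsThetaAutomorphism (n : ℕ) (p : W.FunctionFieldˣ × W.Point) (M : V W n →ₗ[K] V W n) : Prop :=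
  ∃ B : riemannRoch W n →ₗ[K] riemannRoch W n,
    (∀ h : riemannRoch W n,
      (B h : W.FunctionField) = (p.1 : W.FunctionField) * translate W p.2 (h : W.FunctionField)) ∧
    M = B.dualMap

/-- The Heisenberg group `H_n`: the elements of `Θ_n` that act on `V_n` with determinant `1`. -/
def heisenbergGroup (n : ℕ) : Set (W.FunctionFieldˣ × W.Point) :=
  {p | p ∈ thetaGroup W n ∧ ∃ M : V W n →ₗ[K] V W n,
    IsThetaAutomorphism W n p M ∧ LinearMap.det M = 1}

end EllipticTheta

end

set_option linter.unusedSectionVars false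

/-! The function `g` is, up to a constant, the Wronskian of a basis of L(n.O), and a Wronskian
transforms under the theta group by a determinant. Let D be the derivation dual to the invariant
differential and let w be the determinant of the matrix (D^i h_j) for the monomial basis h_j of
L(n.O).

Transformation: D commutes with translations, a change of basis multiplies w by the determinant, and
replacing every h_j by f h_j multiplies w by f^n. Computing the Wronskian of the functions f · τ_T^*
h_j in two ways shows that a Heisenberg element (f, T), which acts with determinant 1, satisfies f^n
· τ_T^* w = w (`pow_mul_translate_monomialWronskian`). Once w = c g, taking N-th powers and applying
τ_{-T}^* gives the invariance of g^N.

Comparison with g: the multiple n of the generic point pulls the invariant differential back to n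
times itself, so in characteristic 0 the map [n] is unramified and div(g) is the sum of the points
of E[n] minus n².O (`mulPullback_eq`). The Wronskian is regular away from O and has a pole of order
exactly n² - 1 at O by a Vandermonde computation with leading terms
(`valuationAt_zero_monomialWronskian`). It vanishes at each non-zero P in E[n], because some
non-zero function in L(n.O) has an n-fold zero at P (`valuationAt_monomialWronskian_lt_one`). Hence
w/g has no poles and is constant (`exists_monomialWronskian_eq_mul`). -/

noncomputable section

namespace EllipticTheta

universe u

/-! ### The invariant derivation -/

section Derivation

variable {K : Type u} [Field K] (W : Affine K) [W.IsElliptic] [IsAlgClosed K] [DecidableEq K]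

/-- The value `2 y + a₁ x + a₃` of the invariant derivation at the coordinate function `x`. -/
def derivX (a b : W.FunctionField) : W.FunctionField :=
  b + b + algebraMap K _ W.a₁ * a + algebraMap K _ W.a₃

/-- The value `3 x² + 2 a₂ x + a₄ - a₁ y` of the invariant derivation at the coordinate
function `y`. -/
def derivY (a b : W.FunctionField) : W.FunctionField :=
  a ^ 2 + a ^ 2 + a ^ 2 + (algebraMap K _ W.a₂ * a + algebraMap K _ W.a₂ * a) +
    algebraMap K _ W.a₄ - algebraMap K _ W.a₁ * b

theorem equation_iff_functionField (a b : W.FunctionField) :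
    (W⁄W.FunctionField).Equation a b ↔
      b ^ 2 + algebraMap K _ W.a₁ * a * b + algebraMap K _ W.a₃ * b =
        a ^ 3 + algebraMap K _ W.a₂ * a ^ 2 + algebraMap K _ W.a₄ * a + algebraMap K _ W.a₆ :=
  Affine.equation_iff _ _

-- An algebra map to the dual numbers lifting the identity is the same as a derivation. The tangent
-- vector (`derivX`, `derivY`) is (F_y, -F_x) for the Weierstrass polynomial F, so the equation
-- holds to first order; this gives the map on the coordinate ring, and it extends to fractions.
open TrivSqZeroExt in
theorem exists_algHom_dualNumber : ∃ φ : W.FunctionField →ₐ[K] DualNumber W.FunctionField,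
    (∀ f, (φ f).fst = f) ∧ (φ (xFun W)).snd = derivX W (xFun W) (yFun W) ∧
      (φ (yFun W)).snd = derivY W (xFun W) (yFun W) := by
  set x := xFun W
  set y := yFun W
  have heq := (equation_iff_functionField W _ _).mp (equation_xFun_yFun W)
  let a : DualNumber W.FunctionField := inl x + inr (derivX W x y)
  let b : DualNumber W.FunctionField := inl y + inr (derivY W x y)
  have hC (c : K) : algebraMap K (DualNumber W.FunctionField) c =
      inl (algebraMap K W.FunctionField c) := rfl
  have hroot : W.polynomial.eval₂
      (aeval a : K[X] →ₐ[K] DualNumber W.FunctionField).toRingHom b = 0 := by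
    have : W.polynomial.eval₂ (aeval a : K[X] →ₐ[K] DualNumber W.FunctionField).toRingHom b =
        b ^ 2 + algebraMap K _ W.a₁ * a * b + algebraMap K _ W.a₃ * b -
        (a ^ 3 + algebraMap K _ W.a₂ * a ^ 2 + algebraMap K _ W.a₄ * a + algebraMap K _ W.a₆) := by
      simp [Affine.polynomial, eval₂_pow]
      ring
    rw [this, hC, hC, hC, hC, hC]
    ext
    · simp [a, b, pow_succ] at heq ⊢
      linear_combination heq
    · simp [a, b, pow_succ, derivX, derivY]
      ring
  let g : W.CoordinateRing →+* DualNumber W.FunctionField := AdjoinRoot.lift _ b hroot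
  have hgX (p : K[X]) : g (algebraMap K[X] W.CoordinateRing p) = aeval a p :=
    AdjoinRoot.lift_of hroot
  have hgC (c : K) : g (algebraMap K W.CoordinateRing c) = algebraMap K _ c := by
    rw [IsScalarTower.algebraMap_apply K K[X] W.CoordinateRing, hgX]
    exact aeval_C a c
  let f : W.CoordinateRing →ₐ[K] DualNumber W.FunctionField := { g with commutes' := hgC }
  have hfst : (fstHom W.FunctionField W.FunctionField W.FunctionField).toRingHom.comp g =
      algebraMap W.CoordinateRing W.FunctionField := by
    refine AdjoinRoot.ringHom_ext ?_ ?_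
    · refine Polynomial.ringHom_ext (fun c => ?_) ?_
      · change (g (algebraMap K W.CoordinateRing c)).fst = _
        rw [hgC]
        rfl
      · change (g (algebraMap K[X] W.CoordinateRing X)).fst = _
        rw [hgX, aeval_X]
        simp [a]
        rfl
    · change (g (AdjoinRoot.root _)).fst = _
      rw [AdjoinRoot.lift_root hroot]
      simp [b]
      rfl
  -- A dual number is invertible as soon as its first component is, so denominators become units.
  have hunit (z : W.CoordinateRing⁰) : IsUnit (f z) := by
    rw [isUnit_iff_isUnit_fst, isUnit_iff_ne_zero]
    have : (f z).fst = algebraMap W.CoordinateRing W.FunctionField z := RingHom.congr_fun hfst z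
    rw [this]
    exact IsFractionRing.to_map_ne_zero_of_mem_nonZeroDivisors z.2
  let φ : W.FunctionField →ₐ[K] DualNumber W.FunctionField :=
    IsLocalization.liftAlgHom (M := W.CoordinateRing⁰) (f := f) hunit
  have hφ (z : W.CoordinateRing) : φ (algebraMap _ _ z) = g z :=
    IsLocalization.lift_eq (M := W.CoordinateRing⁰) (g := f.toRingHom) hunit z
  refine ⟨φ, fun z => ?_, ?_, ?_⟩
  · have : (fstHom W.FunctionField W.FunctionField W.FunctionField).toRingHom.comp φ.toRingHom =
        RingHom.id _ := by
      refine IsLocalization.ringHom_ext W.CoordinateRing⁰ (RingHom.ext fun z => ?_)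
      exact (congrArg fst (hφ z)).trans (RingHom.congr_fun hfst z)
    exact RingHom.congr_fun this z
  · have : φ x = a := (hφ _).trans ((hgX X).trans (aeval_X a))
    rw [this]
    simp [a]
  · have : φ y = b := (hφ _).trans (AdjoinRoot.lift_root hroot)
    rw [this]
    simp [b]

theorem exists_invariantDerivation : ∃ D : Derivation K W.FunctionField W.FunctionField,
    D (xFun W) = derivX W (xFun W) (yFun W) ∧ D (yFun W) = derivY W (xFun W) (yFun W) := by
  obtain ⟨φ, h1, h2, h3⟩ := exists_algHom_dualNumber W
  refine ⟨Derivation.mk' ((TrivSqZeroExt.sndHom W.FunctionField W.FunctionField).restrictScalars K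
    ∘ₗ φ.toLinearMap) fun a b => ?_, h2, h3⟩
  simp only [LinearMap.comp_apply, AlgHom.toLinearMap_apply, LinearMap.restrictScalars_apply,
    TrivSqZeroExt.sndHom_apply, map_mul, DualNumber.snd_mul, h1, smul_eq_mul]
  ring

/-- The derivation of the function field dual to the invariant differential
`dx / (2 y + a₁ x + a₃)`. -/
def invDeriv : Derivation K W.FunctionField W.FunctionField :=
  (exists_invariantDerivation W).choose

theorem invDeriv_xFun : invDeriv W (xFun W) = derivX W (xFun W) (yFun W) :=
  (exists_invariantDerivation W).choose_spec.1

theorem invDeriv_yFun : invDeriv W (yFun W) = derivY W (xFun W) (yFun W) :=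
  (exists_invariantDerivation W).choose_spec.2

@[simp]
theorem invDeriv_algebraMap (c : K) : invDeriv W (algebraMap K _ c) = 0 :=
  (invDeriv W).map_algebraMap c

/-- An algebra homomorphism out of the function field is determined by the images of `x`
and `y`. -/
theorem algHom_functionField_ext {A : Type*} [CommRing A] [Algebra K A]
    {φ ψ : W.FunctionField →ₐ[K] A}
    (hx : φ (xFun W) = ψ (xFun W)) (hy : φ (yFun W) = ψ (yFun W)) : φ = ψ := by
  have : φ.toRingHom = ψ.toRingHom := by
    refine IsLocalization.ringHom_ext W.CoordinateRing⁰ (AdjoinRoot.ringHom_ext ?_ hy)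
    refine Polynomial.ringHom_ext (fun c => ?_) hx
    exact (φ.commutes c).trans (ψ.commutes c).symm
  exact AlgHom.ext (RingHom.congr_fun this)

end Derivation

/-! ### Pull-backs of the invariant differential -/

section Multiplier

variable {K : Type u} [Field K] (W : Affine K) [W.IsElliptic] [IsAlgClosed K] [DecidableEq K]

theorem negY_functionField (a b : W.FunctionField) :
    (W⁄W.FunctionField).negY a b =
      -b - algebraMap K _ W.a₁ * a - algebraMap K _ W.a₃ := rfl

theorem addX_functionField (a b l : W.FunctionField) :
    (W⁄W.FunctionField).addX a b l =
      l ^ 2 + algebraMap K _ W.a₁ * l - algebraMap K _ W.a₂ - a - b := rfl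

/-- The rational map `E → E` given by the point `Q` of `E` over `K(E)` pulls the invariant
differential `ω` back to `c ω`. -/
def HasMultiplier : (W⁄W.FunctionField).Point → W.FunctionField → Prop
  | .zero, c => c = 0
  | .some a b _, c => invDeriv W a = c * derivX W a b ∧ invDeriv W b = c * derivY W a b

variable {W}

/-- These are the partial derivatives of the Weierstrass polynomial up to sign, so this is
nonsingularity. It makes the multiplier of a point unique. -/
theorem derivX_ne_zero_or {a b : W.FunctionField} (h : (W⁄W.FunctionField).Nonsingular a b) :
    derivX W a b ≠ 0 ∨ derivY W a b ≠ 0 := by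
  rcases ((Affine.nonsingular_iff' _ _).mp h).2 with h | h
  · right
    contrapose! h
    simp only [derivY] at h
    simp only [WeierstrassCurve.baseChange, map_a₁, map_a₂, map_a₄]
    linear_combination -h
  · left
    rw [derivX, ← two_mul]
    exact h

theorem HasMultiplier.eq {Q : (W⁄W.FunctionField).Point} {c d : W.FunctionField}
    (hc : HasMultiplier W Q c) (hd : HasMultiplier W Q d) : c = d := by
  match Q with
  | .zero => exact Eq.trans hc (Eq.symm hd)
  | .some a b h =>
    rcases derivX_ne_zero_or h with h | h
    · exact mul_right_cancel₀ h (hc.1.symm.trans hd.1)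
    · exact mul_right_cancel₀ h (hc.2.symm.trans hd.2)

theorem HasMultiplier.neg {Q : (W⁄W.FunctionField).Point} {c : W.FunctionField}
    (hc : HasMultiplier W Q c) : HasMultiplier W (-Q) (-c) := by
  match Q with
  | .zero => exact neg_eq_zero.mpr hc
  | .some a b h =>
    obtain ⟨h1, h2⟩ := hc
    refine ⟨?_, ?_⟩
    · rw [h1, negY_functionField]
      simp only [derivX]
      ring
    · rw [negY_functionField]
      simp only [map_sub, map_neg, Derivation.leibniz, invDeriv_algebraMap, smul_eq_mul, h1, h2]
      simp only [derivX, derivY]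
      ring

/-- The derivative of a Weierstrass equation along a line through two points of the curve. -/
theorem derivY_sub_slope_mul_derivX {x₁ x₂ y₁ y₂ : W.FunctionField}
    (h₁ : (W⁄W.FunctionField).Equation x₁ y₁) (h₂ : (W⁄W.FunctionField).Equation x₂ y₂)
    (hxy : ¬(x₁ = x₂ ∧ y₁ = (W⁄W.FunctionField).negY x₂ y₂)) {l : W.FunctionField}
    (hl : l = (W⁄W.FunctionField).slope x₁ x₂ y₁ y₂) :
    derivY W x₁ y₁ - l * derivX W x₁ y₁ =
      (x₁ - x₂) * (x₁ - (W⁄W.FunctionField).addX x₁ x₂ l) := by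
  by_cases hx : x₁ = x₂
  -- Tangent case: the right side vanishes and the identity is the definition of the tangent slope.
  · have hy : y₁ ≠ (W⁄W.FunctionField).negY x₂ y₂ := fun h => hxy ⟨hx, h⟩
    have hyy := Affine.Y_eq_of_Y_ne h₁ h₂ hx hy
    subst hx hyy
    rw [Affine.slope_of_Y_ne rfl hy, eq_div_iff (sub_ne_zero.mpr hy), negY_functionField] at hl
    simp only [derivX, derivY]
    simp only [WeierstrassCurve.baseChange, map_a₁, map_a₂, map_a₄] at hl
    linear_combination -hl
  · rw [Affine.slope_of_X_ne hx, eq_div_iff (sub_ne_zero.mpr hx)] at hl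
    obtain rfl : y₂ = y₁ - l * (x₁ - x₂) := by linear_combination hl
    -- Chord case: after multiplication by `x₁ - x₂` the identity is the difference of the two curve
    -- equations.
    rw [equation_iff_functionField] at h₁ h₂
    refine mul_left_cancel₀ (sub_ne_zero.mpr hx) ?_
    rw [addX_functionField]
    simp only [derivX, derivY]
    linear_combination h₂ - h₁

/-- For a chord, differentiate l (x₁ - x₂) = y₁ - y₂; by `derivY_sub_slope_mul_derivX` at both
points every term is divisible by x₁ - x₂. For a tangent the two multipliers agree, and l · `derivX`
= `derivY` is differentiated instead. The outcome has the same shape in both cases, so the addition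
law needs no further case split. -/
theorem HasMultiplier.invDeriv_slope {x₁ x₂ y₁ y₂ c₁ c₂ : W.FunctionField}
    {h₁ : (W⁄W.FunctionField).Nonsingular x₁ y₁} {h₂ : (W⁄W.FunctionField).Nonsingular x₂ y₂}
    (hxy : ¬(x₁ = x₂ ∧ y₁ = (W⁄W.FunctionField).negY x₂ y₂)) {l : W.FunctionField}
    (hl : l = (W⁄W.FunctionField).slope x₁ x₂ y₁ y₂)
    (hc₁ : HasMultiplier W (.some _ _ h₁) c₁) (hc₂ : HasMultiplier W (.some _ _ h₂) c₂) :
    invDeriv W l = c₁ * (x₁ - (W⁄W.FunctionField).addX x₁ x₂ l) +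
      c₂ * (x₂ - (W⁄W.FunctionField).addX x₁ x₂ l) := by
  have hA := derivY_sub_slope_mul_derivX h₁.1 h₂.1 hxy hl
  by_cases hx : x₁ = x₂
  · have hy : y₁ ≠ (W⁄W.FunctionField).negY x₂ y₂ := fun h => hxy ⟨hx, h⟩
    have hyy := Affine.Y_eq_of_Y_ne h₁.1 h₂.1 hx hy
    subst hx hyy
    obtain rfl := hc₁.eq hc₂
    have hM : derivX W x₁ y₁ ≠ 0 := by
      rw [negY_functionField] at hy
      contrapose! hy
      simp only [derivX] at hy
      linear_combination hy
    have hN : l * derivX W x₁ y₁ = derivY W x₁ y₁ := by linear_combination -hA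
    have hD := congrArg (invDeriv W) hN
    simp only [Derivation.leibniz, smul_eq_mul] at hD
    refine mul_right_cancel₀ hM ?_
    have hDX : invDeriv W (derivX W x₁ y₁) =
        c₁ * (2 * derivY W x₁ y₁ + algebraMap K _ W.a₁ * derivX W x₁ y₁) := by
      conv_lhs => rw [derivX]
      simp only [map_add, Derivation.leibniz, invDeriv_algebraMap, smul_eq_mul,
        hc₁.1, hc₁.2]
      ring
    have hDY : invDeriv W (derivY W x₁ y₁) =
        c₁ * ((6 * x₁ + 2 * algebraMap K _ W.a₂) * derivX W x₁ y₁ -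
          algebraMap K _ W.a₁ * derivY W x₁ y₁) := by
      conv_lhs => rw [derivY]
      simp only [map_add, map_sub, pow_two, Derivation.leibniz, invDeriv_algebraMap,
        smul_eq_mul, hc₁.1, hc₁.2]
      ring
    rw [hDX, hDY] at hD
    rw [addX_functionField]
    linear_combination hD + c₁ * (algebraMap K _ W.a₁ + 2 * l) * hN
  · have hl' := hl
    rw [Affine.slope_of_X_ne hx, eq_div_iff (sub_ne_zero.mpr hx)] at hl'
    have hl2 : l = (W⁄W.FunctionField).slope x₂ x₁ y₂ y₁ := by
      rw [hl, Affine.slope_of_X_ne hx, Affine.slope_of_X_ne (Ne.symm hx), ← neg_sub y₁,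
        ← neg_sub x₁, neg_div_neg_eq]
    have hB := derivY_sub_slope_mul_derivX h₂.1 h₁.1 (fun h => hx h.1.symm) hl2
    have hcomm : (W⁄W.FunctionField).addX x₂ x₁ l = (W⁄W.FunctionField).addX x₁ x₂ l := by
      rw [addX_functionField, addX_functionField]
      ring
    rw [hcomm] at hB
    have hD := congrArg (invDeriv W) hl'
    simp only [Derivation.leibniz, smul_eq_mul, map_sub, hc₁.1, hc₁.2, hc₂.1, hc₂.2] at hD
    refine mul_left_cancel₀ (sub_ne_zero.mpr hx) ?_
    linear_combination hD + c₁ * hA - c₂ * hB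

/-- The multiplier of a sum of points is the sum of the multipliers. -/
theorem HasMultiplier.add {P Q : (W⁄W.FunctionField).Point} {c₁ c₂ : W.FunctionField}
    (hc₁ : HasMultiplier W P c₁) (hc₂ : HasMultiplier W Q c₂) :
    HasMultiplier W (P + Q) (c₁ + c₂) := by
  match P, Q with
  | .zero, Q =>
    obtain rfl : c₁ = 0 := hc₁
    rw [← Affine.Point.zero_def, zero_add, zero_add]
    exact hc₂
  | .some _ _ h, .zero =>
    obtain rfl : c₂ = 0 := hc₂
    rw [← Affine.Point.zero_def, add_zero, add_zero]
    exact hc₁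
  | .some x₁ y₁ h₁, .some x₂ y₂ h₂ =>
    by_cases hxy : x₁ = x₂ ∧ y₁ = (W⁄W.FunctionField).negY x₂ y₂
    · have hneg : Affine.Point.some _ _ h₁ = -Affine.Point.some _ _ h₂ := by
        rw [Affine.Point.neg_some, Affine.Point.some.injEq]
        exact hxy
      rw [Affine.Point.add_of_Y_eq hxy.1 hxy.2]
      rw [hneg] at hc₁
      -- The points are opposite, so uniqueness of the multiplier forces c₁ = -c₂.
      rw [hc₁.eq hc₂.neg, neg_add_cancel]
      exact rfl
    · rw [Affine.Point.add_some hxy]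
      set l := (W⁄W.FunctionField).slope x₁ x₂ y₁ y₂ with hl
      have hA := derivY_sub_slope_mul_derivX h₁.1 h₂.1 hxy hl
      have hD := HasMultiplier.invDeriv_slope hxy hl hc₁ hc₂
      -- Both points lie on the line of slope `l`, for chords and tangents alike; this eliminates
      -- `y₂`.
      have hline : y₂ = y₁ + l * (x₂ - x₁) := by
        by_cases hx : x₁ = x₂
        · have := Affine.Y_eq_of_Y_ne h₁.1 h₂.1 hx (fun h => hxy ⟨hx, h⟩)
          rw [hx, this]
          ring
        · rw [hl, Affine.slope_of_X_ne hx]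
          field_simp [sub_ne_zero.mpr hx]
          ring
      set x₃ := (W⁄W.FunctionField).addX x₁ x₂ l with hx₃
      have hx₃' : x₃ = _ := addX_functionField W x₁ x₂ l
      have hy₃ : (W⁄W.FunctionField).addY x₁ x₂ y₁ l = -(l * (x₃ - x₁) + y₁) -
        algebraMap K _ W.a₁ * x₃ - algebraMap K _ W.a₃ := rfl
      have hDx : invDeriv W x₃ =
          (c₁ + c₂) * derivX W x₃ ((W⁄W.FunctionField).addY x₁ x₂ y₁ l) := by
        conv_lhs => rw [hx₃']
        simp only [map_add, map_sub, pow_two, Derivation.leibniz, invDeriv_algebraMap,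
          smul_eq_mul, hc₁.1, hc₂.1, hD]
        rw [hy₃]
        simp only [derivX]
        rw [hline]
        ring
      refine ⟨hDx, ?_⟩
      change invDeriv W ((W⁄W.FunctionField).addY x₁ x₂ y₁ l) =
        (c₁ + c₂) * derivY W x₃ ((W⁄W.FunctionField).addY x₁ x₂ y₁ l)
      conv_lhs => rw [hy₃]
      simp only [map_add, map_sub, map_neg, Derivation.leibniz, invDeriv_algebraMap,
        smul_eq_mul, hc₁.1, hc₁.2, hD, hDx]
      rw [hy₃]
      simp only [derivX, derivY] at hA ⊢
      rw [hx₃'] at hA ⊢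
      linear_combination -(2 * c₁ + c₂) * hA

theorem hasMultiplier_constPoint (T : W.Point) : HasMultiplier W (constPoint W T) 0 := by
  match T with
  | .zero => exact rfl
  | .some x y h =>
    constructor
    · exact (invDeriv_algebraMap W x).trans (zero_mul _).symm
    · exact (invDeriv_algebraMap W y).trans (zero_mul _).symm

theorem hasMultiplier_genericPoint : HasMultiplier W (genericPoint W) 1 :=
  ⟨(invDeriv_xFun W).trans (one_mul _).symm, (invDeriv_yFun W).trans (one_mul _).symm⟩

/-- This is [n]^* ω = n ω, from which unramifiedness in characteristic 0 is deduced. -/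
theorem hasMultiplier_nsmul (n : ℕ) : HasMultiplier W (n • genericPoint W) n := by
  induction n with
  | zero =>
    rw [zero_nsmul, Nat.cast_zero]
    exact rfl
  | succ n ih =>
    rw [succ_nsmul, Nat.cast_succ]
    exact ih.add hasMultiplier_genericPoint

/-- The function field is generated by `x` and `y`. -/
theorem intermediateField_eq_top (S : IntermediateField K W.FunctionField)
    (hx : xFun W ∈ S) (hy : yFun W ∈ S) : S = ⊤ := by
  have hR (z : W.CoordinateRing) : algebraMap _ W.FunctionField z ∈ S := by
    obtain ⟨p, rfl⟩ := AdjoinRoot.mk_surjective z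
    have hC (q : K[X]) : algebraMap _ W.FunctionField (AdjoinRoot.mk W.polynomial (C q)) ∈ S := by
      induction q using Polynomial.induction_on' with
      | add p q hp hq => simpa only [map_add] using add_mem hp hq
      | monomial k c =>
        rw [← C_mul_X_pow_eq_monomial, map_mul, map_mul, map_mul, map_pow, map_pow, map_pow]
        exact mul_mem (S.algebraMap_mem c) (pow_mem hx k)
    induction p using Polynomial.induction_on' with
    | add p q hp hq => simpa only [map_add] using add_mem hp hq
    | monomial k c =>
      rw [← C_mul_X_pow_eq_monomial, map_mul, map_mul, map_pow, map_pow]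
      exact mul_mem (hC c) (pow_mem hy k)
  rw [eq_top_iff]
  intro f _
  obtain ⟨a, b, _, rfl⟩ := IsFractionRing.div_surjective (A := W.CoordinateRing) f
  exact div_mem (hR a) (hR b)

variable (W) in
/-- The invariant derivation commutes with translations. -/
theorem invDeriv_translate (T : W.Point) (f : W.FunctionField) :
    invDeriv W (translate W T f) = translate W T (invDeriv W f) := by
  set τ := translate W T
  -- Translation invariance of ω: the point η + T has multiplier 1 + 0.
  have h : HasMultiplier W (Affine.Point.map (W' := W) τ (genericPoint W)) 1 := by
    rw [map_translate_genericPoint]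
    simpa using hasMultiplier_genericPoint.add (hasMultiplier_constPoint T)
  have hx : invDeriv W (τ (xFun W)) = τ (invDeriv W (xFun W)) := by
    rw [invDeriv_xFun]
    refine h.1.trans ?_
    simp only [derivX, map_add, map_mul, AlgHom.commutes, one_mul]
  have hy : invDeriv W (τ (yFun W)) = τ (invDeriv W (yFun W)) := by
    rw [invDeriv_yFun]
    refine h.2.trans ?_
    simp only [derivY, map_add, map_sub, map_mul, map_pow, AlgHom.commutes, one_mul]
  -- The functions on which D and the translation commute form a subfield, so it suffices to test x
  -- and y.
  let S : IntermediateField K W.FunctionField :=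
    { carrier := {f | invDeriv W (τ f) = τ (invDeriv W f)}
      add_mem' := fun {a b} ha hb => by
        simp only [Set.mem_ofPred_eq, map_add] at ha hb ⊢
        rw [ha, hb]
      mul_mem' := fun {a b} ha hb => by
        simp only [Set.mem_ofPred_eq, map_add, map_mul, Derivation.leibniz, smul_eq_mul] at ha hb ⊢
        rw [ha, hb]
      algebraMap_mem' := fun c => by
        simp only [Set.mem_ofPred_eq, AlgHom.commutes, invDeriv_algebraMap, map_zero]
      inv_mem' := fun a ha => by
        simp only [Set.mem_ofPred_eq, map_inv₀, Derivation.leibniz_inv, smul_eq_mul, map_mul,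
          map_neg, map_pow] at ha ⊢
        rw [ha] }
  have : f ∈ S := by
    rw [intermediateField_eq_top S hx hy]
    trivial
  exact this

end Multiplier

/-! ### Valuations and the invariant derivation -/

section Valuations

variable {K : Type u} [Field K] (W : Affine K) [W.IsElliptic] [IsAlgClosed K]

theorem valuationAt_zero_algebraMap {r : W.CoordinateRing} (hr : r ≠ 0) :
    valuationAt W 0 (algebraMap _ _ r) = WithZero.exp (poleOrder W r : ℤ) := by
  change Valuation.extendToLocalization _ (infinityValuation_supp W) _ _ = _
  rw [Valuation.extendToLocalization_apply_map_apply]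
  exact if_neg hr

theorem valuationAt_algebraMap_coordinateRing_le_one {P : W.Point} (hP : P ≠ 0)
    (r : W.CoordinateRing) : valuationAt W P (algebraMap _ _ r) ≤ 1 := by
  match P with
  | .zero => exact absurd rfl hP
  | .some _ _ h => exact (affinePlace W h).valuation_le_one r

theorem valuationAt_algebraMap_eq_one (P : W.Point) {c : K} (hc : c ≠ 0) :
    valuationAt W P (algebraMap K _ c) = 1 := by
  refine le_antisymm (valuationAt_algebraMap_le_one W P c) ?_
  have h := valuationAt_algebraMap_le_one W P c⁻¹
  rw [map_inv₀, map_inv₀] at h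
  have h0 : valuationAt W P (algebraMap K _ c) ≠ 0 := by
    rw [Valuation.ne_zero_iff]
    exact (_root_.map_ne_zero _).mpr hc
  exact (inv_le_one₀ (zero_lt_iff.mpr h0)).mp h

theorem exp_log_valuationAt (P : W.Point) {f : W.FunctionField} (hf : f ≠ 0) :
    valuationAt W P f = WithZero.exp (-ord W P f) := by
  rw [ord, neg_neg, WithZero.exp_log ((Valuation.ne_zero_iff _).mpr hf)]

theorem algebraMap_smul_basis (p q : K[X]) :
    algebraMap W.CoordinateRing W.FunctionField
      (p • (1 : W.CoordinateRing) + q • Affine.CoordinateRing.mk W Y) =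
    aeval (xFun W) p + aeval (xFun W) q * yFun W := by
  have h (s : K[X]) : algebraMap W.CoordinateRing W.FunctionField
      (Affine.CoordinateRing.mk W (C s)) = aeval (xFun W) s := by
    have : (algebraMap W.CoordinateRing W.FunctionField).comp (algebraMap K[X] W.CoordinateRing) =
        (aeval (xFun W) : K[X] →ₐ[K] W.FunctionField).toRingHom := by
      refine Polynomial.ringHom_ext (fun c => ?_) ?_
      · simp only [AlgHom.toRingHom_eq_coe, RingHom.coe_coe, aeval_C, RingHom.comp_apply]
        rfl
      · simp only [AlgHom.toRingHom_eq_coe, RingHom.coe_coe, aeval_X, RingHom.comp_apply]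
        rfl
    exact RingHom.congr_fun this s
  rw [map_add, Affine.CoordinateRing.smul, Affine.CoordinateRing.smul, mul_one, map_mul, h, h]
  rfl

theorem valuationAt_zero_algebraMap_of_norm {r : W.CoordinateRing} {q : K[X]}
    (hr : Algebra.norm K[X] r = q) (hq : q ≠ 0) :
    valuationAt W 0 (algebraMap _ _ r) = WithZero.exp (q.natDegree : ℤ) := by
  have h0 : r ≠ 0 := by
    rintro rfl
    exact hq (hr.symm.trans (Algebra.norm_zero (S := W.CoordinateRing)))
  rw [valuationAt_zero_algebraMap W h0, poleOrder, hr]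

theorem valuationAt_zero_aeval {p : K[X]} (hp : p ≠ 0) :
    valuationAt W 0 (aeval (xFun W) p) = WithZero.exp (2 * p.natDegree : ℤ) := by
  have h := algebraMap_smul_basis W p 0
  rw [map_zero, zero_mul, add_zero] at h
  rw [← h, valuationAt_zero_algebraMap_of_norm W _ (pow_ne_zero 2 hp), natDegree_pow]
  · simp
  · rw [Affine.CoordinateRing.norm_smul_basis]
    ring

theorem valuationAt_zero_xFun : valuationAt W 0 (xFun W) = WithZero.exp 2 := by
  have h := valuationAt_zero_aeval W (X_ne_zero (R := K))
  rwa [aeval_X, natDegree_X] at h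

theorem valuationAt_zero_yFun : valuationAt W 0 (yFun W) = WithZero.exp 3 := by
  have h := algebraMap_smul_basis W 0 1
  rw [map_zero, zero_add, map_one, one_mul] at h
  have hd : (1 * X ^ 3 + C W.a₂ * X ^ 2 + C W.a₄ * X + C W.a₆ : K[X]).natDegree = 3 := by
    rw [← C_1, natDegree_cubic one_ne_zero]
  have hnorm := Affine.CoordinateRing.norm_smul_basis (W' := W) 0 1
  rw [← h, valuationAt_zero_algebraMap_of_norm W (q := -(1 * X ^ 3 + C W.a₂ * X ^ 2 + C W.a₄ * X +
    C W.a₆)) (by rw [hnorm]; ring), natDegree_neg, hd]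
  · rfl
  · intro h0
    rw [neg_eq_zero] at h0
    rw [h0] at hd
    simp at hd

theorem invDeriv_aeval_xFun [DecidableEq K] (p : K[X]) :
    invDeriv W (aeval (xFun W) p) =
      aeval (xFun W) (derivative p) * derivX W (xFun W) (yFun W) := by
  rw [Derivation.map_aeval, invDeriv_xFun, smul_eq_mul]

theorem valuationAt_zero_derivX_le :
    valuationAt W 0 (derivX W (xFun W) (yFun W)) ≤ WithZero.exp 3 := by
  have h1 (c : K) := valuationAt_algebraMap_le_one W 0 c
  have hy := (valuationAt_zero_yFun W).le
  refine Valuation.map_add_le _ (Valuation.map_add_le _ (Valuation.map_add_le _ hy hy) ?_) ?_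
  · rw [map_mul, valuationAt_zero_xFun]
    exact (mul_le_of_le_one_left' (h1 _)).trans (by simp)
  · exact (h1 _).trans (by simp [← WithZero.exp_zero])

theorem valuationAt_zero_derivY_le :
    valuationAt W 0 (derivY W (xFun W) (yFun W)) ≤ WithZero.exp 4 := by
  have h1 (c : K) := valuationAt_algebraMap_le_one W 0 c
  have hx : valuationAt W 0 (xFun W ^ 2) ≤ WithZero.exp 4 := by
    rw [map_pow, valuationAt_zero_xFun, ← WithZero.exp_nsmul]
    rfl
  have hax : valuationAt W 0 (algebraMap K _ W.a₂ * xFun W) ≤ WithZero.exp 4 := by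
    rw [map_mul, valuationAt_zero_xFun]
    exact (mul_le_of_le_one_left' (h1 _)).trans (by simp)
  refine Valuation.map_sub_le _ (Valuation.map_add_le _ (Valuation.map_add_le _
    (Valuation.map_add_le _ (Valuation.map_add_le _ hx hx) hx) (Valuation.map_add_le _ hax hax))
      ?_) ?_
  · exact (h1 _).trans (by simp [← WithZero.exp_zero])
  · rw [map_mul, valuationAt_zero_yFun]
    exact (mul_le_of_le_one_left' (h1 _)).trans (by simp)

/-- Differentiating p lowers its degree, hence the pole order by at least 2, while `derivX`
contributes at most 3. -/
theorem valuationAt_zero_invDeriv_aeval_le [DecidableEq K] (p : K[X]) :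
    valuationAt W 0 (invDeriv W (aeval (xFun W) p)) ≤
      WithZero.exp 1 * valuationAt W 0 (aeval (xFun W) p) := by
  rw [invDeriv_aeval_xFun, map_mul]
  by_cases hp : derivative p = 0
  · simp [hp]
  have hd : p.natDegree ≠ 0 := by
    intro h
    exact hp (derivative_of_natDegree_zero h)
  rw [valuationAt_zero_aeval W hp, valuationAt_zero_aeval W (fun h => hp (by simp [h])),
    ← WithZero.exp_add]
  refine (mul_le_mul_right (valuationAt_zero_derivX_le W) _).trans ?_
  rw [← WithZero.exp_add, WithZero.exp_le_exp]
  have := natDegree_derivative_lt hd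
  omega

theorem invDeriv_mul_valuation_le [DecidableEq K] {P : W.Point} {a b : W.FunctionField}
    (ha : valuationAt W P (invDeriv W a) ≤ WithZero.exp 1 * valuationAt W P a)
    (hb : valuationAt W P (invDeriv W b) ≤ WithZero.exp 1 * valuationAt W P b) :
    valuationAt W P (invDeriv W (a * b)) ≤ WithZero.exp 1 * valuationAt W P (a * b) := by
  rw [Derivation.leibniz]
  refine Valuation.map_add_le _ ?_ ?_
  · rw [smul_eq_mul, map_mul, map_mul, mul_left_comm]
    gcongr
  · rw [smul_eq_mul, map_mul, map_mul, mul_comm (valuationAt W P a), mul_left_comm]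
    gcongr

/-- The pole orders of p(x) and q(x) y have different parity, so no cancellation occurs in the sum
and each summand can be bounded separately. -/
theorem valuationAt_zero_invDeriv_algebraMap_le [DecidableEq K] (r : W.CoordinateRing) :
    valuationAt W 0 (invDeriv W (algebraMap _ _ r)) ≤
      WithZero.exp 1 * valuationAt W 0 (algebraMap _ _ r) := by
  obtain ⟨p, q, rfl⟩ := Affine.CoordinateRing.exists_smul_basis_eq r
  rw [algebraMap_smul_basis]
  have hp := valuationAt_zero_invDeriv_aeval_le W p
  have hq := invDeriv_mul_valuation_le W (valuationAt_zero_invDeriv_aeval_le W q)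
    (b := yFun W) (by
      rw [invDeriv_yFun, valuationAt_zero_yFun, ← WithZero.exp_add]
      exact valuationAt_zero_derivY_le W)
  by_cases hp0 : p = 0
  · simpa [hp0] using hq
  by_cases hq0 : q = 0
  · simpa [hq0] using hp
  have hne : valuationAt W 0 (aeval (xFun W) p) ≠ valuationAt W 0 (aeval (xFun W) q * yFun W) := by
    rw [map_mul, valuationAt_zero_aeval W hp0, valuationAt_zero_aeval W hq0, valuationAt_zero_yFun,
      ← WithZero.exp_add, Ne, WithZero.exp_inj]
    omega
  rw [Valuation.map_add_of_distinct_val _ hne, map_add]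
  refine Valuation.map_add_le _ (hp.trans ?_) (hq.trans ?_)
  · gcongr
    exact le_max_left _ _
  · gcongr
    exact le_max_right _ _

/-! ### Order bounds for the derivation at affine points. -/

theorem exists_algebraMap_eq_invDeriv [DecidableEq K] (r : W.CoordinateRing) :
    ∃ s : W.CoordinateRing, algebraMap _ _ s = invDeriv W (algebraMap _ _ r) := by
  change invDeriv W _ ∈ (algebraMap W.CoordinateRing W.FunctionField).range
  set S := (algebraMap W.CoordinateRing W.FunctionField).range
  have hx : xFun W ∈ S := ⟨_, rfl⟩
  have hy : yFun W ∈ S := ⟨_, rfl⟩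
  have hc (c : K) : algebraMap K W.FunctionField c ∈ S := ⟨algebraMap K W.CoordinateRing c, rfl⟩
  have hp (p : K[X]) : aeval (xFun W) p ∈ S := by
    have := algebraMap_smul_basis W p 0
    rw [map_zero, zero_mul, add_zero] at this
    exact ⟨_, this⟩
  have hdx : derivX W (xFun W) (yFun W) ∈ S :=
    add_mem (add_mem (add_mem hy hy) (mul_mem (hc _) hx)) (hc _)
  have hax := mul_mem (hc W.a₂) hx
  have hxx := pow_mem hx 2
  have hdy : derivY W (xFun W) (yFun W) ∈ S :=
    sub_mem (add_mem (add_mem (add_mem (add_mem hxx hxx) hxx) (add_mem hax hax)) (hc _))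
      (mul_mem (hc _) hy)
  obtain ⟨p, q, rfl⟩ := Affine.CoordinateRing.exists_smul_basis_eq r
  rw [algebraMap_smul_basis, map_add, Derivation.leibniz, invDeriv_aeval_xFun, invDeriv_aeval_xFun,
    invDeriv_yFun, smul_eq_mul, smul_eq_mul]
  exact add_mem (mul_mem (hp _) hdx) (add_mem (mul_mem (hp _) hdy)
    (mul_mem hy (mul_mem (hp _) hdx)))

/-- Induction on k: I^(k+1) is spanned additively by products ab with a in I^k and b in I, and the
Leibniz rule loses at most one order on each. -/
theorem valuation_invDeriv_of_mem_pow [DecidableEq K] {x y : K} (h : W.Nonsingular x y) (k : ℕ)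
    {r : W.CoordinateRing} (hr : r ∈ (affinePlace W h).asIdeal ^ k) :
    valuationAt W (.some _ _ h) (invDeriv W (algebraMap _ _ r)) ≤
      WithZero.exp (1 - k : ℤ) := by
  set v := valuationAt W (.some _ _ h)
  have hv (r : W.CoordinateRing) : v (algebraMap _ _ r) = (affinePlace W h).intValuation r :=
    (affinePlace W h).valuation_of_algebraMap r
  have hD (r : W.CoordinateRing) : v (invDeriv W (algebraMap _ _ r)) ≤ 1 := by
    obtain ⟨s, hs⟩ := exists_algebraMap_eq_invDeriv W r
    rw [← hs, hv]
    exact (affinePlace W h).intValuation_le_one s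
  induction k generalizing r with
  | zero => exact (hD r).trans (by simp [← WithZero.exp_zero])
  | succ k ih =>
    rw [pow_succ] at hr
    refine Submodule.mul_induction_on hr (fun a ha b hb => ?_) (fun a b ha hb => ?_)
    · have ha' := ((affinePlace W h).intValuation_le_pow_iff_mem a k).mpr ha
      have hb' := ((affinePlace W h).intValuation_le_pow_iff_mem b 1).mpr (by rwa [pow_one])
      rw [← hv] at ha' hb'
      rw [map_mul, Derivation.leibniz, smul_eq_mul, smul_eq_mul]
      refine Valuation.map_add_le _ ?_ ?_
      · rw [map_mul]
        refine (mul_le_mul' ha' (hD b)).trans ?_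
        rw [mul_one, WithZero.exp_le_exp]
        push_cast
        omega
      · rw [map_mul]
        refine (mul_le_mul' hb' (ih ha)).trans ?_
        rw [← WithZero.exp_add, WithZero.exp_le_exp]
        push_cast
        omega
    · rw [map_add, map_add]
      exact Valuation.map_add_le _ ha hb

/-- The invariant derivation lowers the order of vanishing at a point by at most one. -/
theorem valuationAt_invDeriv_le [DecidableEq K] (P : W.Point) (f : W.FunctionField) :
    valuationAt W P (invDeriv W f) ≤ WithZero.exp 1 * valuationAt W P f := by
  have hR (r : W.CoordinateRing) : valuationAt W P (invDeriv W (algebraMap _ _ r)) ≤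
      WithZero.exp 1 * valuationAt W P (algebraMap _ _ r) := by
    match P with
    | .zero => exact valuationAt_zero_invDeriv_algebraMap_le W r
    | .some x y h =>
      by_cases hr : r = 0
      · simp [hr]
      have hv : valuationAt W (.some _ _ h) (algebraMap _ _ r) =
        (affinePlace W h).intValuation r := (affinePlace W h).valuation_of_algebraMap r
      obtain ⟨k, hk⟩ : ∃ k : ℕ, (affinePlace W h).intValuation r = WithZero.exp (-(k : ℤ)) :=
        ⟨_, (affinePlace W h).intValuation_if_neg hr⟩
      rw [hv, hk, ← WithZero.exp_add]
      exact valuation_invDeriv_of_mem_pow W h k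
        (((affinePlace W h).intValuation_le_pow_iff_mem r k).mp hk.le)
  obtain ⟨a, b, hb, rfl⟩ := IsFractionRing.div_surjective (A := W.CoordinateRing) f
  have hb0 : valuationAt W P (algebraMap W.CoordinateRing _ b) ≠ 0 := by
    rw [Valuation.ne_zero_iff]
    exact IsFractionRing.to_map_ne_zero_of_mem_nonZeroDivisors hb
  set a' := algebraMap W.CoordinateRing W.FunctionField a
  set b' := algebraMap W.CoordinateRing W.FunctionField b
  have hab : valuationAt W P (b' • invDeriv W a' - a' • invDeriv W b') ≤
      WithZero.exp 1 * valuationAt W P a' * valuationAt W P b' := by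
    refine Valuation.map_sub_le _ ?_ ?_
    · rw [smul_eq_mul, map_mul, mul_comm]
      gcongr
      exact hR a
    · rw [smul_eq_mul, map_mul, mul_comm _ (valuationAt W P a'), mul_assoc]
      gcongr
      exact hR b
  rw [Derivation.leibniz_div, smul_eq_mul, map_mul, map_div₀, map_pow, map_inv₀]
  refine (mul_le_mul_right hab _).trans (le_of_eq ?_)
  field_simp

end Valuations

/-! ### The kernel of reduction at a point -/

section Reduction

variable {K : Type u} [Field K] {W : Affine K} [W.IsElliptic] [IsAlgClosed K] [DecidableEq K]

variable (W) in
/-- The rational map `E → E` given by a point of `E` over `K(E)` maps the point `P` to `O`. -/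
def MapsToZero (P : W.Point) : (W⁄W.FunctionField).Point → Prop
  | .zero => True
  | .some a _ _ => 1 < valuationAt W P a

/-- At a pole of a the equation reads b² ~ a³, so the pole order of b is 3/2 that of a. Only the
strict bounds on either side of this ratio are needed. -/
theorem valuationAt_lt_sq_and_lt {P : W.Point} {a b : W.FunctionField}
    (h : (W⁄W.FunctionField).Equation a b) (ha : 1 < valuationAt W P a) :
    valuationAt W P b < valuationAt W P a ^ 2 ∧ valuationAt W P a < valuationAt W P b := by
  rw [equation_iff_functionField] at h
  set v := valuationAt W P
  have hc (c : K) : v (algebraMap K _ c) ≤ 1 := valuationAt_algebraMap_le_one W P c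
  have ha0 : 0 < v a := zero_lt_one.trans ha
  have h12 : v a < v a ^ 2 := lt_self_pow₀ ha (by norm_num)
  have h23 : v a ^ 2 < v a ^ 3 := pow_lt_pow_right₀ ha (by norm_num)
  have h34 : v a ^ 3 < v a ^ 4 := pow_lt_pow_right₀ ha (by norm_num)
  have hmul {c : K} {z : W.FunctionField} : v (algebraMap K _ c * z) ≤ v z := by
    rw [map_mul]
    exact mul_le_of_le_one_left' (hc c)
  have hR : v (a ^ 3 + algebraMap K _ W.a₂ * a ^ 2 + algebraMap K _ W.a₄ * a +
      algebraMap K _ W.a₆) = v a ^ 3 := by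
    rw [add_assoc, add_assoc, Valuation.map_add_eq_of_lt_left, map_pow]
    rw [map_pow]
    refine lt_of_le_of_lt ?_ h23
    refine Valuation.map_add_le _ (hmul.trans (map_pow v a 2).le) (Valuation.map_add_le _ ?_ ?_)
    · exact hmul.trans h12.le
    · exact (hc _).trans (ha.trans h12).le
  rw [← h] at hR
  constructor
  · by_contra! hb
    have hab : v a < v b := h12.trans_le hb
    have hb1 : 1 < v b := ha.trans hab
    have hL : v (b ^ 2 + algebraMap K _ W.a₁ * a * b + algebraMap K _ W.a₃ * b) = v b ^ 2 := by
      rw [add_assoc, Valuation.map_add_eq_of_lt_left, map_pow]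
      rw [map_pow, sq]
      refine Valuation.map_add_lt _ ?_ ?_
      · rw [mul_assoc]
        refine hmul.trans_lt ?_
        rw [map_mul]
        exact mul_lt_mul_of_pos_right hab (zero_lt_one.trans hb1)
      · refine hmul.trans_lt ?_
        exact lt_mul_of_one_lt_left (zero_lt_one.trans hb1) hb1
    rw [hL] at hR
    have : v a ^ 4 ≤ v b ^ 2 := by
      calc v a ^ 4 = (v a ^ 2) ^ 2 := by rw [← pow_mul]
        _ ≤ v b ^ 2 := by gcongr
    exact absurd (h34.trans_le this) (by rw [hR]; exact lt_irrefl _)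
  · by_contra! hb
    have hL : v (b ^ 2 + algebraMap K _ W.a₁ * a * b + algebraMap K _ W.a₃ * b) ≤ v a ^ 2 := by
      refine Valuation.map_add_le _ (Valuation.map_add_le _ ?_ ?_) ?_
      · rw [map_pow]
        gcongr
      · rw [mul_assoc]
        refine hmul.trans ?_
        rw [map_mul, sq]
        gcongr
      · exact hmul.trans (hb.trans h12.le)
    exact absurd (hL.trans_lt h23) (by rw [hR]; exact lt_irrefl _)

theorem valuationAt_Y_le_one {P : W.Point} {a b : W.FunctionField}
    (h : (W⁄W.FunctionField).Equation a b) (ha : valuationAt W P a ≤ 1) :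
    valuationAt W P b ≤ 1 := by
  rw [equation_iff_functionField] at h
  set v := valuationAt W P
  have hc (c : K) : v (algebraMap K _ c) ≤ 1 := valuationAt_algebraMap_le_one W P c
  by_contra! hb
  have hb0 : 0 < v b := zero_lt_one.trans hb
  have hR : a ^ 3 + algebraMap K _ W.a₂ * a ^ 2 + algebraMap K _ W.a₄ * a +
      algebraMap K _ W.a₆ ∈ v.integer :=
    add_mem (add_mem (add_mem (pow_mem ha 3) (mul_mem (hc _) (pow_mem ha 2))) (mul_mem (hc _) ha))
      (hc _)
  have hL : v (b ^ 2 + algebraMap K _ W.a₁ * a * b + algebraMap K _ W.a₃ * b) = v b ^ 2 := by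
    have hlt : v b < v b ^ 2 := lt_self_pow₀ hb (by norm_num)
    rw [add_assoc, Valuation.map_add_eq_of_lt_left, map_pow]
    rw [map_pow]
    refine Valuation.map_add_lt _ ?_ ?_
    · rw [map_mul]
      exact (mul_le_of_le_one_left' (mul_mem (hc _) ha : _ ∈ v.integer)).trans_lt hlt
    · rw [map_mul]
      exact (mul_le_of_le_one_left' (hc _)).trans_lt hlt
  rw [← h] at hR
  exact absurd (hL.symm.le.trans hR) (not_le.mpr (one_lt_pow₀ hb (by norm_num)))

theorem MapsToZero.neg {P : W.Point} {Q : (W⁄W.FunctionField).Point} (hQ : MapsToZero W P Q) :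
    MapsToZero W P (-Q) := by
  match Q with
  | .zero => exact hQ
  | .some _ _ _ => exact hQ

/-- In this asymmetric form the two x-coordinates differ automatically, so only the chord formula
has to be estimated. Closure of the kernel of reduction under addition then follows formally. -/
theorem not_mapsToZero_add {P : W.Point} {Q R : (W⁄W.FunctionField).Point}
    (hQ : ¬ MapsToZero W P Q) (hR : MapsToZero W P R) : ¬ MapsToZero W P (Q + R) := by
  match Q, R with
  | .zero, _ => exact absurd trivial hQ
  | .some x y h, .zero => exact hQ
  | .some x y h, .some a b h' =>
    replace hQ : valuationAt W P x ≤ 1 := not_lt.mp hQ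
    replace hR : 1 < valuationAt W P a := hR
    have hy := valuationAt_Y_le_one h.1 hQ
    have hb := (valuationAt_lt_sq_and_lt h'.1 hR).1
    have hx : x ≠ a := fun hxa => absurd hR (by rw [← hxa]; exact not_lt.mpr hQ)
    rw [Affine.Point.add_of_X_ne hx, MapsToZero, Affine.slope_of_X_ne hx, addX_functionField,
      not_lt]
    have heq := (equation_iff_functionField W _ _).mp h'.1
    set v := valuationAt W P
    have hc (c : K) : algebraMap K _ c ∈ v.integer := valuationAt_algebraMap_le_one W P c
    have hxS : x ∈ v.integer := hQ
    have hyS : y ∈ v.integer := hy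
    have hva : v (x - a) = v a := Valuation.map_sub_eq_of_lt_right _ (hQ.trans_lt hR)
    -- Using the equation of (a, b) to replace b² cancels the a³ terms; what is left has size at
    -- most v(a)², which is the size of the denominator.
    have key : (((y - b) / (x - a)) ^ 2 + algebraMap K _ W.a₁ * ((y - b) / (x - a)) -
        algebraMap K _ W.a₂ - x - a) * (x - a) ^ 2 =
        x * a ^ 2 + (algebraMap K _ W.a₄ - algebraMap K _ W.a₁ * y +
          (algebraMap K _ W.a₂ * x + algebraMap K _ W.a₂ * x) + x ^ 2) * a -
        (algebraMap K _ W.a₃ + y + y + algebraMap K _ W.a₁ * x) * b +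
        (algebraMap K _ W.a₆ + y ^ 2 + algebraMap K _ W.a₁ * x * y - algebraMap K _ W.a₂ * x ^ 2 -
          x ^ 3) := by
      field_simp [sub_ne_zero.mpr hx]
      linear_combination heq
    have h12 : v a < v a ^ 2 := lt_self_pow₀ hR (by norm_num)
    have hle {c z : W.FunctionField} (hcS : c ∈ v.integer) (hz : v z ≤ v a ^ 2) :
        v (c * z) ≤ v a ^ 2 := by
      rw [map_mul]
      exact (mul_le_of_le_one_left' hcS).trans hz
    have hnum := congrArg v key
    rw [map_mul, map_pow, hva] at hnum
    refine le_of_mul_le_mul_right ?_ (pow_pos (zero_lt_one.trans hR) 2)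
    rw [hnum, one_mul]
    have h2 := mul_mem (hc W.a₂) hxS
    have h1 := mul_mem (hc W.a₁) hxS
    refine Valuation.map_add_le _ (Valuation.map_sub_le _ (Valuation.map_add_le _ ?_ ?_) ?_) ?_
    · exact hle hxS (map_pow v a 2).le
    · exact hle (add_mem (add_mem (sub_mem (hc _) (mul_mem (hc _) hyS)) (add_mem h2 h2))
        (pow_mem hxS 2)) h12.le
    · exact hle (add_mem (add_mem (add_mem (hc _) hyS) hyS) h1) hb.le
    · refine le_trans ?_ (hR.trans h12).le
      exact sub_mem (sub_mem (add_mem (add_mem (hc _) (pow_mem hyS 2)) (mul_mem h1 hyS))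
        (mul_mem (hc _) (pow_mem hxS 2))) (pow_mem hxS 3)

/-- If Q + R were not in the kernel, adding -R, which is, would put Q outside it. -/
theorem MapsToZero.add {P : W.Point} {Q R : (W⁄W.FunctionField).Point}
    (hQ : MapsToZero W P Q) (hR : MapsToZero W P R) : MapsToZero W P (Q + R) := by
  by_contra h
  have := not_mapsToZero_add h hR.neg
  rw [add_neg_cancel_right] at this
  exact this hQ

theorem MapsToZero.nsmul {P : W.Point} {Q : (W⁄W.FunctionField).Point}
    (hQ : MapsToZero W P Q) (n : ℕ) : MapsToZero W P (n • Q) := by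
  induction n with
  | zero =>
    rw [zero_nsmul]
    exact trivial
  | succ n ih =>
    rw [succ_nsmul]
    exact ih.add hQ

theorem valuationAt_xFun_sub_lt_one {x y : K} (h : W.Nonsingular x y) :
    valuationAt W (.some _ _ h) (xFun W - algebraMap K _ x) < 1 := by
  have : xFun W - algebraMap K _ x =
      algebraMap W.CoordinateRing W.FunctionField (Affine.CoordinateRing.XClass W x) := by
    rw [Affine.CoordinateRing.XClass, C_sub, map_sub, map_sub]
    rfl
  rw [this]
  exact ((affinePlace W h).valuation_lt_one_iff_mem _).mpr
    (Ideal.subset_span (Set.mem_insert _ _))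

theorem valuationAt_yFun_sub_lt_one {x y : K} (h : W.Nonsingular x y) :
    valuationAt W (.some _ _ h) (yFun W - algebraMap K _ y) < 1 := by
  have : yFun W - algebraMap K _ y =
      algebraMap W.CoordinateRing W.FunctionField (Affine.CoordinateRing.YClass W (C y)) := by
    rw [Affine.CoordinateRing.YClass, map_sub, map_sub]
    rfl
  rw [this]
  exact ((affinePlace W h).valuation_lt_one_iff_mem _).mpr
    (Ideal.subset_span (Set.mem_insert_of_mem _ rfl))

/-- This is the slope of the chord through the generic point and -P. If P ≠ -P, the numerator is a
unit at P and the denominator vanishes. If P = -P, both vanish and nonsingularity decides. -/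
theorem one_lt_valuationAt_slope {x y : K} (h : W.Nonsingular x y) :
    1 < valuationAt W (.some _ _ h) ((yFun W - algebraMap K _ (W.negY x y)) /
      (xFun W - algebraMap K _ x)) := by
  have hx := valuationAt_xFun_sub_lt_one h
  have hy := valuationAt_yFun_sub_lt_one h
  have heq := (equation_iff_functionField W _ _).mp (equation_xFun_yFun W)
  have heq0 := congrArg (algebraMap K W.FunctionField) ((Affine.equation_iff _ _).mp h.1)
  have hns := ((Affine.nonsingular_iff' _ _).mp h).2
  have hX : xFun W - algebraMap K _ x ≠ 0 := sub_ne_zero.mpr (xFun_ne_algebraMap W x)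
  set v := valuationAt W (.some _ _ h)
  have hX0 : 0 < v (xFun W - algebraMap K _ x) := zero_lt_iff.mpr ((Valuation.ne_zero_iff _).mpr hX)
  have hc (c : K) : algebraMap K _ c ∈ v.integer := valuationAt_algebraMap_le_one W _ c
  have hx' : xFun W ∈ v.integer := by simpa using add_mem (show _ ∈ v.integer from hx.le) (hc x)
  by_cases h2 : y = W.negY x y
  · have hG0 : 3 * x ^ 2 + 2 * W.a₂ * x + W.a₄ - W.a₁ * y ≠ 0 := by
      rcases hns with hns | hns
      · contrapose! hns
        linear_combination -hns
      · refine absurd ?_ hns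
        rw [Affine.negY] at h2
        linear_combination h2
    have hvG0 := valuationAt_algebraMap_eq_one W (.some _ _ h) hG0
    set l := (yFun W - algebraMap K _ (W.negY x y)) / (xFun W - algebraMap K _ x) with hl
    have hl' : l * (xFun W - algebraMap K _ x) = yFun W - algebraMap K _ y := by
      rw [hl, div_mul_cancel₀ _ hX, ← h2]
    -- The Weierstrass equation expanded at P and divided by x - x(P). The right side is a unit at P
    -- and y - y(P) vanishes there, so `l` must have a pole.
    have key : (yFun W - algebraMap K _ y) * (l + algebraMap K _ W.a₁) =
        algebraMap K _ (3 * x ^ 2 + 2 * W.a₂ * x + W.a₄ - W.a₁ * y) +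
        (xFun W - algebraMap K _ x) * (xFun W + (algebraMap K _ x + algebraMap K _ x) +
          algebraMap K _ W.a₂) := by
      refine mul_right_cancel₀ hX ?_
      rw [Affine.negY] at h2
      have h2' := congrArg (algebraMap K W.FunctionField) h2
      simp only [map_add, map_sub, map_mul, map_pow, map_neg, map_ofNat] at heq0 h2' ⊢
      linear_combination heq - heq0 + (yFun W - algebraMap K _ y) * hl' -
        (yFun W - algebraMap K _ y) * h2'
    have hv : v ((yFun W - algebraMap K _ y) * (l + algebraMap K _ W.a₁)) = 1 := by
      rw [key, Valuation.map_add_eq_of_lt_left, hvG0]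
      rw [hvG0, map_mul]
      exact mul_lt_one_of_lt_of_le hx (add_mem (add_mem hx' (add_mem (hc _) (hc _))) (hc _))
    by_contra! hle
    rw [map_mul] at hv
    exact absurd hv (mul_lt_one_of_lt_of_le hy (add_mem (show l ∈ v.integer from hle) (hc _))).ne
  · have hvc := valuationAt_algebraMap_eq_one W (.some _ _ h) (sub_ne_zero.mpr h2)
    have : yFun W - algebraMap K _ (W.negY x y) =
        (yFun W - algebraMap K _ y) + algebraMap K _ (y - W.negY x y) := by
      rw [map_sub]
      ring
    rw [map_div₀, this, Valuation.map_add_eq_of_lt_right _ (by rwa [hvc]), hvc, one_div]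
    exact (one_lt_inv₀ hX0).mpr hx

/-- The generic point specialises to P at P. For affine P the x-coordinate of the difference is
dominated by the square of the chord slope. -/
theorem mapsToZero_genericPoint_sub (P : W.Point) :
    MapsToZero W P (genericPoint W - constPoint W P) := by
  match P with
  | .zero =>
    rw [← Affine.Point.zero_def, map_zero, sub_zero]
    change 1 < valuationAt W 0 (xFun W)
    rw [valuationAt_zero_xFun, ← WithZero.exp_zero, WithZero.exp_lt_exp]
    norm_num
  | .some x y h =>
    have hl := one_lt_valuationAt_slope h
    have hx := (valuationAt_xFun_sub_lt_one h).le
    have hne : xFun W ≠ algebraMap K _ x := xFun_ne_algebraMap W x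
    obtain ⟨h', e⟩ : ∃ h', constPoint W (-.some _ _ h) =
      .some (algebraMap K W.FunctionField x) (algebraMap K W.FunctionField (W.negY x y)) h' :=
      ⟨_, rfl⟩
    rw [sub_eq_add_neg, ← map_neg, e, genericPoint, Affine.Point.add_of_X_ne hne,
      MapsToZero, Affine.slope_of_X_ne hne, addX_functionField]
    set l := (yFun W - algebraMap K _ (W.negY x y)) / (xFun W - algebraMap K _ x)
    set v := valuationAt W (.some _ _ h)
    have hc (c : K) : algebraMap K _ c ∈ v.integer := valuationAt_algebraMap_le_one W _ c
    have hx' : xFun W ∈ v.integer := by simpa using add_mem (show _ ∈ v.integer from hx) (hc x)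
    have hlt : v l < v l ^ 2 := lt_self_pow₀ hl (by norm_num)
    have : v (l ^ 2 + (algebraMap K _ W.a₁ * l - algebraMap K _ W.a₂ - xFun W -
        algebraMap K _ x)) = v l ^ 2 := by
      rw [Valuation.map_add_eq_of_lt_left, map_pow]
      rw [map_pow]
      refine lt_of_le_of_lt ?_ hlt
      refine Valuation.map_sub_le _ (Valuation.map_sub_le _ (Valuation.map_sub_le _ ?_ ?_) ?_) ?_
      · rw [map_mul]
        exact mul_le_of_le_one_left' (hc _)
      · exact le_trans (hc _) hl.le
      · exact le_trans hx' hl.le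
      · exact le_trans (hc _) hl.le
    rw [show l ^ 2 + algebraMap K _ W.a₁ * l - algebraMap K _ W.a₂ - xFun W - algebraMap K _ x =
      l ^ 2 + (algebraMap K _ W.a₁ * l - algebraMap K _ W.a₂ - xFun W - algebraMap K _ x) by ring,
      this]
    exact hl.trans hlt

/-- The derivative of the parameter a/b is c times a unit, and D lowers orders by at most one, so
a/b vanishes to order at most one; it does vanish because b has the larger pole. -/
theorem valuationAt_localParameter {P : W.Point} {Q : (W⁄W.FunctionField).Point}
    (hQ : MapsToZero W P Q) {c : K} (hc0 : c ≠ 0) (hc : HasMultiplier W Q (algebraMap K _ c)) :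
    valuationAt W P (localParameter W Q) = WithZero.exp (-1) := by
  match Q with
  | .zero =>
    exact absurd ((_root_.map_eq_zero _).mp hc) hc0
  | .some a b h =>
    change valuationAt W P (a / b) = _
    replace hQ : 1 < valuationAt W P a := hQ
    have hab := (valuationAt_lt_sq_and_lt h.1 hQ).2
    have heq := (equation_iff_functionField W _ _).mp h.1
    obtain ⟨hDa, hDb⟩ := hc
    have hDle := valuationAt_invDeriv_le W P (a / b)
    have hvc := valuationAt_algebraMap_eq_one W P hc0
    set v := valuationAt W P
    have hcS (c : K) : algebraMap K _ c ∈ v.integer := valuationAt_algebraMap_le_one W P c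
    have hb1 : 1 < v b := hQ.trans hab
    have hvb : 0 < v b := zero_lt_one.trans hb1
    have hb0 : b ≠ 0 := (Valuation.ne_zero_iff v).mp hvb.ne'
    -- The quotient rule gives 2b² - 3a³ + ..., and eliminating a³ by the equation leaves -b² as the
    -- dominant term.
    have hD : invDeriv W (a / b) * b ^ 2 = algebraMap K _ c * (-b ^ 2 +
        ((-algebraMap K _ W.a₁ * a * b - (algebraMap K _ W.a₃ + algebraMap K _ W.a₃) * b) +
        (algebraMap K _ W.a₂ * a ^ 2 + (algebraMap K _ W.a₄ + algebraMap K _ W.a₄) * a) +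
        (algebraMap K _ W.a₆ + algebraMap K _ W.a₆ + algebraMap K _ W.a₆))) := by
      rw [Derivation.leibniz_div, hDa, hDb, smul_eq_mul, smul_eq_mul, smul_eq_mul, inv_pow,
        mul_comm, mul_inv_cancel_left₀ (pow_ne_zero 2 hb0)]
      simp only [derivX, derivY]
      linear_combination (3 * algebraMap K W.FunctionField c) * heq
    have hlt : v b < v b ^ 2 := lt_self_pow₀ hb1 (by norm_num)
    have hmul {c z : W.FunctionField} (hcS : c ∈ v.integer) (hz : v z < v b ^ 2) :
        v (c * z) < v b ^ 2 := by
      rw [map_mul]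
      exact (mul_le_of_le_one_left' hcS).trans_lt hz
    have hvD : v (invDeriv W (a / b)) = 1 := by
      have := congrArg v hD
      rw [map_mul, map_mul, hvc, one_mul, Valuation.map_add_eq_of_lt_left, Valuation.map_neg,
        map_pow] at this
      · exact mul_right_cancel₀ (pow_ne_zero 2 hvb.ne') (this.trans (one_mul _).symm)
      rw [Valuation.map_neg, map_pow]
      refine Valuation.map_add_lt _ (Valuation.map_add_lt _ (Valuation.map_sub_lt _ ?_ ?_)
        (Valuation.map_add_lt _ ?_ ?_)) ?_
      · rw [mul_assoc]
        refine hmul (neg_mem (hcS _)) ?_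
        rw [map_mul, sq]
        exact mul_lt_mul_of_pos_right hab hvb
      · exact hmul (add_mem (hcS _) (hcS _)) hlt
      · refine hmul (hcS _) ?_
        rw [map_pow]
        exact pow_lt_pow_left₀ hab zero_le (by norm_num)
      · exact hmul (add_mem (hcS _) (hcS _)) (hab.trans hlt)
      · exact lt_of_le_of_lt (add_mem (add_mem (hcS _) (hcS _)) (hcS _)) (hb1.trans hlt)
    have hv1 : v (a / b) < 1 := by
      rw [map_div₀]
      exact (div_lt_one₀ hvb).mpr hab
    rw [hvD] at hDle
    have h0 : v (a / b) ≠ 0 := by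
      intro h0
      rw [h0, mul_zero] at hDle
      exact absurd hDle (not_le.mpr zero_lt_one)
    rw [← WithZero.exp_log h0] at hDle hv1 ⊢
    rw [← WithZero.exp_zero, ← WithZero.exp_add, WithZero.exp_le_exp] at hDle
    rw [← WithZero.exp_zero, WithZero.exp_lt_exp] at hv1
    rw [WithZero.exp_inj]
    omega

/-- In characteristic zero multiplication by `n` is unramified. -/
theorem mulPullback_eq [CharZero K] {n : ℕ} (hn : n ≠ 0) :
    mulPullback W n = fun P => if n • P = 0 then 1 else 0 := by
  funext P
  rw [mulPullback]
  split_ifs with h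
  -- Since nP = O, the point nη is n times a point that reduces to O at P.
  · have hnP : n • (genericPoint W - constPoint W P) = n • genericPoint W := by
      rw [nsmul_sub, ← map_nsmul, h, map_zero, sub_zero]
    have hred := (mapsToZero_genericPoint_sub P).nsmul n
    rw [hnP] at hred
    have hmul := hasMultiplier_nsmul (W := W) n
    rw [← map_natCast (algebraMap K W.FunctionField)] at hmul
    rw [ord, valuationAt_localParameter hred (Nat.cast_ne_zero.mpr hn) hmul, WithZero.log_exp]
    rfl
  · rfl

end Reduction

/-! ### Determinants and valuations -/

section DetValuation

variable {R Γ : Type*} [CommRing R] [LinearOrderedCommGroupWithZero Γ] (v : Valuation R Γ)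

theorem valuation_prod_sub_prod_lt_one {ι : Type*} (s : Finset ι) {a b : ι → R}
    (hb : ∀ i, v (b i) ≤ 1) (hab : ∀ i, v (a i - b i) < 1) :
    v (∏ i ∈ s, a i - ∏ i ∈ s, b i) < 1 := by
  classical
  induction s using Finset.induction_on with
  | empty => simp
  | insert i s hi ih =>
    have ha : v (a i) ≤ 1 := by
      simpa using Valuation.map_add_le v (hab i).le (hb i)
    have hp : v (∏ i ∈ s, b i) ≤ 1 := by
      rw [map_prod]
      exact Finset.prod_le_one' fun i _ => hb i
    rw [Finset.prod_insert hi, Finset.prod_insert hi,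
      show a i * ∏ i ∈ s, a i - b i * ∏ i ∈ s, b i =
        a i * (∏ i ∈ s, a i - ∏ i ∈ s, b i) + (a i - b i) * ∏ i ∈ s, b i by ring]
    refine Valuation.map_add_lt v ?_ ?_
    · rw [map_mul]
      exact (mul_le_of_le_one_left' ha).trans_lt ih
    · rw [map_mul]
      exact mul_lt_one_of_lt_of_le (hab i) hp

theorem valuation_sign_smul {n : Type*} [Fintype n] [DecidableEq n] (σ : Equiv.Perm n) (r : R) :
    v (Equiv.Perm.sign σ • r) = v r := by
  rcases Int.units_eq_one_or (Equiv.Perm.sign σ) with h | h <;> simp [h]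

theorem valuation_det_sub_det_lt_one {n : Type*} [Fintype n] [DecidableEq n] {A B : Matrix n n R}
    (hB : ∀ i j, v (B i j) ≤ 1) (hAB : ∀ i j, v (A i j - B i j) < 1) :
    v (A.det - B.det) < 1 := by
  rw [Matrix.det_apply, Matrix.det_apply, ← Finset.sum_sub_distrib]
  refine Valuation.map_sum_lt v one_ne_zero fun σ _ => ?_
  rw [← smul_sub, valuation_sign_smul]
  exact valuation_prod_sub_prod_lt_one v _ (fun i => hB _ _) fun i => hAB _ _

theorem valuation_det_le_one {n : Type*} [Fintype n] [DecidableEq n] {A : Matrix n n R}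
    (hA : ∀ i j, v (A i j) ≤ 1) : v A.det ≤ 1 := by
  rw [Matrix.det_apply]
  refine Valuation.map_sum_le v fun σ _ => ?_
  rw [valuation_sign_smul, map_prod]
  exact Finset.prod_le_one' fun i _ => hA _ _

end DetValuation

/-! ### Leading terms of derivatives at the point at infinity -/

section Wronskian

variable {K : Type u} [Field K] {W : Affine K} [W.IsElliptic] [IsAlgClosed K] [DecidableEq K]

variable (W) in
/-- The function `y / x`, with a simple pole at the point at infinity. -/
def invLocal : W.FunctionField := yFun W / xFun W

variable (W) in
/-- The logarithmic derivative of `h` is `m y / x` up to functions regular at infinity. -/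
def HasLeadingExponent (h : W.FunctionField) (m : ℤ) : Prop :=
  h ≠ 0 ∧ valuationAt W 0 (invDeriv W h - m * invLocal W * h) <
    WithZero.exp 1 * valuationAt W 0 h

theorem xFun_ne_zero : xFun W ≠ 0 := by
  simpa using xFun_ne_algebraMap W 0

theorem yFun_ne_zero : yFun W ≠ 0 := by
  rw [← Valuation.ne_zero_iff (valuationAt W 0), valuationAt_zero_yFun]
  exact WithZero.exp_ne_zero

theorem valuationAt_pos (P : W.Point) {h : W.FunctionField} (hh : h ≠ 0) :
    0 < valuationAt W P h :=
  zero_lt_iff.mpr ((Valuation.ne_zero_iff _).mpr hh)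

theorem valuationAt_zero_invLocal : valuationAt W 0 (invLocal W) = WithZero.exp 1 := by
  rw [invLocal, map_div₀, valuationAt_zero_yFun, valuationAt_zero_xFun, ← WithZero.exp_sub]
  rfl

theorem invLocal_ne_zero : invLocal W ≠ 0 := div_ne_zero yFun_ne_zero xFun_ne_zero

theorem HasLeadingExponent.mul {a b : W.FunctionField} {m k : ℤ} (ha : HasLeadingExponent W a m)
    (hb : HasLeadingExponent W b k) : HasLeadingExponent W (a * b) (m + k) := by
  refine ⟨mul_ne_zero ha.1 hb.1, ?_⟩
  have : invDeriv W (a * b) - (m + k : ℤ) * invLocal W * (a * b) =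
      a * (invDeriv W b - k * invLocal W * b) + b * (invDeriv W a - m * invLocal W * a) := by
    rw [Derivation.leibniz, smul_eq_mul, smul_eq_mul]
    push_cast
    ring
  rw [this, map_mul]
  refine Valuation.map_add_lt _ ?_ ?_
  · rw [map_mul, mul_left_comm]
    exact mul_lt_mul_of_pos_left hb.2 (valuationAt_pos 0 ha.1)
  · rw [map_mul, mul_comm (valuationAt W 0 a), mul_left_comm]
    exact mul_lt_mul_of_pos_left ha.2 (valuationAt_pos 0 hb.1)

theorem HasLeadingExponent.inv {a : W.FunctionField} {m : ℤ} (ha : HasLeadingExponent W a m) :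
    HasLeadingExponent W a⁻¹ (-m) := by
  refine ⟨inv_ne_zero ha.1, ?_⟩
  have ha0 := ha.1
  have : invDeriv W a⁻¹ - (-m : ℤ) * invLocal W * a⁻¹ =
      -(a⁻¹ * a⁻¹ * (invDeriv W a - m * invLocal W * a)) := by
    rw [Derivation.leibniz_inv, smul_eq_mul]
    push_cast
    field_simp
    ring
  have hv := valuationAt_pos 0 (inv_ne_zero ha0)
  rw [this, Valuation.map_neg, map_mul, map_mul]
  refine (mul_lt_mul_of_pos_left ha.2 (mul_pos hv hv)).trans_eq ?_
  rw [map_inv₀]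
  have := (valuationAt_pos 0 ha0).ne'
  field_simp

theorem hasLeadingExponent_one : HasLeadingExponent W 1 0 := by
  refine ⟨one_ne_zero, ?_⟩
  simp

theorem HasLeadingExponent.pow {a : W.FunctionField} {m : ℤ} (ha : HasLeadingExponent W a m)
    (k : ℕ) : HasLeadingExponent W (a ^ k) (k * m) := by
  induction k with
  | zero => simpa using hasLeadingExponent_one
  | succ k ih =>
    have := ih.mul ha
    rw [pow_succ, show ((k + 1 : ℕ) : ℤ) * m = k * m + m by push_cast; ring]
    exact this

theorem hasLeadingExponent_xFun : HasLeadingExponent W (xFun W) 2 := by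
  refine ⟨xFun_ne_zero, ?_⟩
  have : invDeriv W (xFun W) - (2 : ℤ) * invLocal W * xFun W =
      algebraMap K _ W.a₁ * xFun W + algebraMap K _ W.a₃ := by
    rw [invDeriv_xFun, invLocal]
    have := xFun_ne_zero (W := W)
    simp only [derivX]
    push_cast
    field_simp
    ring
  have h1 (c : K) := valuationAt_algebraMap_le_one W 0 c
  rw [this, valuationAt_zero_xFun, ← WithZero.exp_add]
  refine Valuation.map_add_lt _ ?_ ?_
  · rw [map_mul, valuationAt_zero_xFun]
    exact (mul_le_of_le_one_left' (h1 _)).trans_lt (by simp)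
  · exact (h1 _).trans_lt (by simp [← WithZero.exp_zero])

theorem hasLeadingExponent_yFun : HasLeadingExponent W (yFun W) 3 := by
  refine ⟨yFun_ne_zero, ?_⟩
  have heq := (equation_iff_functionField W _ _).mp (equation_xFun_yFun W)
  -- Multiplying by x clears the denominator; the terms 3x³ - 3y² collapse by the curve equation,
  -- leaving pole order at most 5 instead of 6.
  have key : (invDeriv W (yFun W) - (3 : ℤ) * invLocal W * yFun W) * xFun W =
      -algebraMap K _ W.a₂ * xFun W ^ 2 - (algebraMap K _ W.a₄ + algebraMap K _ W.a₄) * xFun W -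
      (algebraMap K _ W.a₆ + algebraMap K _ W.a₆ + algebraMap K _ W.a₆) +
      (algebraMap K _ W.a₁ + algebraMap K _ W.a₁) * (xFun W * yFun W) +
      (algebraMap K _ W.a₃ + algebraMap K _ W.a₃ + algebraMap K _ W.a₃) * yFun W := by
    rw [invDeriv_yFun, invLocal]
    have := xFun_ne_zero (W := W)
    simp only [derivY]
    push_cast
    field_simp
    linear_combination (-3) * heq
  set v := valuationAt W 0
  have hx : v (xFun W) = WithZero.exp 2 := valuationAt_zero_xFun W
  have hy : v (yFun W) = WithZero.exp 3 := valuationAt_zero_yFun W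
  have hc (c : K) : algebraMap K _ c ∈ v.integer := valuationAt_algebraMap_le_one W 0 c
  have hle {c z : W.FunctionField} (hcS : c ∈ v.integer) (hz : v z ≤ WithZero.exp 5) :
      v (c * z) ≤ WithZero.exp 5 := by
    rw [map_mul]
    exact (mul_le_of_le_one_left' hcS).trans hz
  have hv : v ((invDeriv W (yFun W) - (3 : ℤ) * invLocal W * yFun W) * xFun W) ≤
      WithZero.exp 5 := by
    rw [key]
    refine Valuation.map_add_le _ (Valuation.map_add_le _ (Valuation.map_sub_le _
      (Valuation.map_sub_le _ ?_ ?_) ?_) ?_) ?_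
    · refine hle (neg_mem (hc _)) ?_
      rw [map_pow, hx, ← WithZero.exp_nsmul, WithZero.exp_le_exp]
      norm_num
    · refine hle (add_mem (hc _) (hc _)) ?_
      rw [hx, WithZero.exp_le_exp]
      norm_num
    · refine le_trans (add_mem (add_mem (hc _) (hc _)) (hc _)) ?_
      rw [← WithZero.exp_zero, WithZero.exp_le_exp]
      norm_num
    · refine hle (add_mem (hc _) (hc _)) ?_
      rw [map_mul, hx, hy, ← WithZero.exp_add, WithZero.exp_le_exp]
      norm_num
    · refine hle (add_mem (add_mem (hc _) (hc _)) (hc _)) ?_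
      rw [hy, WithZero.exp_le_exp]
      norm_num
  rw [map_mul, hx] at hv
  rw [hy, ← WithZero.exp_add]
  refine lt_of_mul_lt_mul_right (hv.trans_lt ?_) (zero_le (a := WithZero.exp (2 : ℤ)))
  rw [← WithZero.exp_add, WithZero.exp_lt_exp]
  norm_num

theorem hasLeadingExponent_invLocal : HasLeadingExponent W (invLocal W) 1 := by
  have := hasLeadingExponent_yFun.mul (hasLeadingExponent_xFun (W := W)).inv
  rwa [← div_eq_mul_inv] at this

/-- Since y/x has exponent 1, the exponent rises by one with each derivative, and the successive
factors m, m+1, ... multiply to a rising factorial. -/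
theorem HasLeadingExponent.iterate {h : W.FunctionField} {m : ℤ} (hh : HasLeadingExponent W h m)
    (i : ℕ) : valuationAt W 0 ((invDeriv W)^[i] h -
      ((ascPochhammer ℤ i).eval m : ℤ) * (invLocal W ^ i * h)) <
        WithZero.exp (i : ℤ) * valuationAt W 0 h := by
  induction i with
  | zero => simpa using valuationAt_pos 0 hh.1
  | succ i ih =>
    set e := (invDeriv W)^[i] h - ((ascPochhammer ℤ i).eval m : ℤ) * (invLocal W ^ i * h) with he
    have hi := (hasLeadingExponent_invLocal.pow (W := W) i).mul hh
    have h1 : (invDeriv W)^[i] h =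
        e + ((ascPochhammer ℤ i).eval m : ℤ) * (invLocal W ^ i * h) := by
      rw [he]
      ring
    have h2 : (invDeriv W)^[i + 1] h -
        ((ascPochhammer ℤ (i + 1)).eval m : ℤ) * (invLocal W ^ (i + 1) * h) =
        invDeriv W e + ((ascPochhammer ℤ i).eval m : ℤ) * (invDeriv W (invLocal W ^ i * h) -
          (i * 1 + m : ℤ) * invLocal W * (invLocal W ^ i * h)) := by
      rw [Function.iterate_succ_apply', h1, map_add, ← zsmul_eq_mul, map_zsmul, zsmul_eq_mul,
        ascPochhammer_succ_eval]
      push_cast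
      ring
    rw [h2, Nat.cast_succ, add_comm (i : ℤ), WithZero.exp_add, mul_assoc (WithZero.exp 1)]
    refine Valuation.map_add_lt _ ?_ ?_
    · exact (valuationAt_invDeriv_le W 0 e).trans_lt
        (mul_lt_mul_of_pos_left ih (WithZero.exp_pos))
    · have hint : valuationAt W 0 (((ascPochhammer ℤ i).eval m : ℤ) : W.FunctionField) ≤ 1 := by
        rw [← map_intCast (algebraMap K W.FunctionField)]
        exact valuationAt_algebraMap_le_one W 0 _
      rw [map_mul]
      refine (mul_le_of_le_one_left' hint).trans_lt (hi.2.trans_eq ?_)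
      rw [map_mul, map_pow, valuationAt_zero_invLocal, ← WithZero.exp_nsmul]
      simp

/-! ### Wronskians and their pole order at infinity. -/

variable (W) in
/-- The Wronskian matrix of a family of functions. -/
def wronskianMatrix {n : ℕ} (h : Fin n → W.FunctionField) :
    Matrix (Fin n) (Fin n) W.FunctionField :=
  Matrix.of fun i j => (invDeriv W)^[i] (h j)

variable (W) in
/-- The Wronskian of a family of functions. -/
def wronskian {n : ℕ} (h : Fin n → W.FunctionField) : W.FunctionField :=
  (wronskianMatrix W h).det

/-- Divide row i by (y/x)^i and column j by h_j. At O the matrix then reduces to the integer matrix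
of rising factorials of the m_j, whose determinant is a Vandermonde determinant: non-zero for
distinct m_j, hence a unit in characteristic 0. -/
theorem valuationAt_zero_wronskian [CharZero K] {n : ℕ} {h : Fin n → W.FunctionField}
    {m : Fin n → ℤ} (hm : Function.Injective m) (hh : ∀ j, HasLeadingExponent W (h j) (m j)) :
    valuationAt W 0 (wronskian W h) =
      (∏ j : Fin n, WithZero.exp (j : ℤ)) * ∏ j, valuationAt W 0 (h j) := by
  let B : Matrix (Fin n) (Fin n) ℤ := Matrix.of fun i j => (ascPochhammer ℤ i).eval (m j)
  have hB : B.det ≠ 0 := by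
    -- The rising factorials are monic of degree i, so they can replace the powers in a Vandermonde
    -- matrix.
    have := Matrix.det_eval_matrixOfPolynomials_eq_det_vandermonde m
      (fun i => ascPochhammer ℤ i) (fun i => ascPochhammer_natDegree _ _)
      (fun i => monic_ascPochhammer _ _)
    rw [← Matrix.det_transpose]
    refine (this.symm.trans_ne ?_ :)
    rwa [Matrix.det_vandermonde_ne_zero_iff]
  let N : Matrix (Fin n) (Fin n) W.FunctionField := Matrix.of fun i j =>
    (invLocal W ^ (i : ℕ))⁻¹ * ((h j)⁻¹ * wronskianMatrix W h i j)
  have hN : N.det = (∏ i : Fin n, (invLocal W ^ (i : ℕ))⁻¹) *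
      ((∏ j, (h j)⁻¹) * wronskian W h) := by
    rw [wronskian, ← Matrix.det_mul_row, ← Matrix.det_mul_column]
    rfl
  let B' : Matrix (Fin n) (Fin n) W.FunctionField := B.map (Int.castRingHom W.FunctionField)
  have hint (z : ℤ) : valuationAt W 0 (z : W.FunctionField) ≤ 1 := by
    rw [← map_intCast (algebraMap K W.FunctionField)]
    exact valuationAt_algebraMap_le_one W 0 _
  have hNB : valuationAt W 0 (N.det - B'.det) < 1 := by
    refine valuation_det_sub_det_lt_one _ (fun i j => hint _) fun i j => ?_
    have hi := (hh j).iterate i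
    have hj0 := (hh j).1
    have hw0 := pow_ne_zero (i : ℕ) (invLocal_ne_zero (W := W))
    have : N i j - B' i j = (invLocal W ^ (i : ℕ))⁻¹ * (h j)⁻¹ * ((invDeriv W)^[i] (h j) -
        ((ascPochhammer ℤ i).eval (m j) : ℤ) * (invLocal W ^ (i : ℕ) * h j)) := by
      simp only [N, B', B, wronskianMatrix, Matrix.map_apply, Matrix.of_apply, eq_intCast]
      field_simp
    have hpos := mul_pos (valuationAt_pos 0 (inv_ne_zero hw0))
      (valuationAt_pos 0 (inv_ne_zero hj0))
    rw [this, map_mul, map_mul]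
    refine (mul_lt_mul_of_pos_left hi hpos).trans_eq ?_
    have h1 := (valuationAt_pos 0 hj0).ne'
    rw [map_inv₀, map_inv₀, map_pow, valuationAt_zero_invLocal, ← WithZero.exp_nsmul,
      nsmul_eq_mul, mul_one]
    field_simp
  have hB' : valuationAt W 0 B'.det = 1 := by
    have : B'.det = algebraMap K W.FunctionField (B.det : K) := by
      rw [map_intCast]
      exact ((Int.castRingHom W.FunctionField).map_det B).symm
    rw [this]
    exact valuationAt_algebraMap_eq_one W 0 (Int.cast_ne_zero.mpr hB)
  have hN1 : valuationAt W 0 N.det = 1 := by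
    rw [← hB'] at hNB ⊢
    have := Valuation.map_add_eq_of_lt_left _ hNB
    rwa [add_sub_cancel] at this
  rw [hN, map_mul, map_mul, map_prod, map_prod] at hN1
  simp only [map_inv₀, map_pow, valuationAt_zero_invLocal, Finset.prod_inv_distrib,
    ← WithZero.exp_nsmul, nsmul_eq_mul, mul_one] at hN1
  have h1 : ∏ j : Fin n, WithZero.exp (j : ℤ) ≠ 0 :=
    Finset.prod_ne_zero_iff.mpr fun _ _ => WithZero.exp_ne_zero
  have h2 : ∏ j, valuationAt W 0 (h j) ≠ 0 :=
    Finset.prod_ne_zero_iff.mpr fun j _ => (valuationAt_pos 0 (hh j).1).ne'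
  rw [inv_mul_eq_iff_eq_mul₀ h1, inv_mul_eq_iff_eq_mul₀ h2, mul_one] at hN1
  rw [hN1, mul_comm]

end Wronskian

/-! ### Riemann-Roch spaces of multiples of the point at infinity -/

section RiemannRoch

variable {K : Type u} [Field K] {W : Affine K} [W.IsElliptic] [IsAlgClosed K] [DecidableEq K]

theorem exists_algebraMap_eq_of_regular {f : W.FunctionField}
    (hf : ∀ P : W.Point, P ≠ 0 → valuationAt W P f ≤ 1) :
    ∃ r : W.CoordinateRing, algebraMap _ _ r = f := by
  refine IsDedekindDomain.HeightOneSpectrum.mem_integers_of_valuation_le_one W.FunctionField f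
    fun v => ?_
  have := v.isMaximal
  obtain ⟨x, y, h, hv⟩ := exists_eq_XYIdeal W v.asIdeal
  obtain rfl : v = affinePlace W h := IsDedekindDomain.HeightOneSpectrum.ext hv
  exact hf (.some _ _ h) (Affine.Point.some_ne_zero h)

variable (W) in
/-- A monomial in `x` and `y` with a pole of order `k` at infinity, for `k ≠ 1`. -/
def poleFun (k : ℕ) : W.FunctionField :=
  if Even k then xFun W ^ (k / 2) else xFun W ^ ((k - 3) / 2) * yFun W

theorem poleFun_two_mul (i : ℕ) : poleFun W (2 * i) = xFun W ^ i := by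
  rw [poleFun, if_pos (even_two_mul i), Nat.mul_div_cancel_left i two_pos]

theorem poleFun_two_mul_add_three (i : ℕ) : poleFun W (2 * i + 3) = xFun W ^ i * yFun W := by
  rw [poleFun, if_neg (by rw [Nat.not_even_iff_odd]; exact ⟨i + 1, by ring⟩), Nat.add_sub_cancel,
    Nat.mul_div_cancel_left i two_pos]

theorem exists_two_mul_or {k : ℕ} (hk : k ≠ 1) : ∃ i, k = 2 * i ∨ k = 2 * i + 3 := by
  rcases Nat.even_or_odd' k with ⟨i, rfl | rfl⟩
  · exact ⟨i, .inl rfl⟩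
  · exact ⟨i - 1, .inr (by omega)⟩

theorem hasLeadingExponent_poleFun {k : ℕ} (hk : k ≠ 1) :
    HasLeadingExponent W (poleFun W k) k := by
  obtain ⟨i, rfl | rfl⟩ := exists_two_mul_or hk
  · have := (hasLeadingExponent_xFun (W := W)).pow i
    rw [poleFun_two_mul]
    convert! this using 1
    push_cast
    ring
  · have := ((hasLeadingExponent_xFun (W := W)).pow i).mul hasLeadingExponent_yFun
    rw [poleFun_two_mul_add_three]
    convert! this using 1
    push_cast
    ring

theorem valuationAt_zero_poleFun {k : ℕ} (hk : k ≠ 1) :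
    valuationAt W 0 (poleFun W k) = WithZero.exp (k : ℤ) := by
  obtain ⟨i, rfl | rfl⟩ := exists_two_mul_or hk
  · rw [poleFun_two_mul, map_pow, valuationAt_zero_xFun, ← WithZero.exp_nsmul, WithZero.exp_inj,
      nsmul_eq_mul]
    push_cast
    ring
  · rw [poleFun_two_mul_add_three, map_mul, map_pow, valuationAt_zero_xFun, ← WithZero.exp_nsmul,
      valuationAt_zero_yFun, ← WithZero.exp_add, WithZero.exp_inj, nsmul_eq_mul]
    push_cast
    ring

theorem poleFun_regular (k : ℕ) {P : W.Point} (hP : P ≠ 0) : valuationAt W P (poleFun W k) ≤ 1 := by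
  have hx : xFun W ∈ (valuationAt W P).integer :=
    valuationAt_algebraMap_coordinateRing_le_one W hP _
  have hy : yFun W ∈ (valuationAt W P).integer :=
    valuationAt_algebraMap_coordinateRing_le_one W hP _
  rw [poleFun]
  split_ifs
  · exact pow_mem hx _
  · exact mul_mem (pow_mem hx _) hy

theorem valuationAt_zero_aeval_sub_lt (p : K[X]) :
    valuationAt W 0 (aeval (xFun W) p - p.leadingCoeff • xFun W ^ p.natDegree) <
      WithZero.exp (2 * p.natDegree : ℤ) := by
  have : aeval (xFun W) p - p.leadingCoeff • xFun W ^ p.natDegree =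
      aeval (xFun W) p.eraseLead := by
    conv_lhs => rw [← p.eraseLead_add_C_mul_X_pow]
    rw [map_add, map_mul, map_pow, aeval_X, aeval_C, ← Algebra.smul_def]
    simp
  rw [this]
  by_cases h0 : p.eraseLead = 0
  · simp [h0]
  · rw [valuationAt_zero_aeval W h0, WithZero.exp_lt_exp]
    have := (eraseLead_natDegree_lt_or_eraseLead_eq_zero p).resolve_right h0
    omega

/-- By parity exactly one of p(x) and q(x) y carries the pole, and its leading monomial is the
required `poleFun`. The orders 2i and 2i + 3 omit only 1. -/
theorem exists_leading_term {r : W.CoordinateRing} (hr : r ≠ 0) :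
    ∃ k : ℕ, k ≠ 1 ∧ valuationAt W 0 (algebraMap _ _ r) = WithZero.exp (k : ℤ) ∧
      ∃ c : K, valuationAt W 0 (algebraMap _ _ r - c • poleFun W k) < WithZero.exp (k : ℤ) := by
  obtain ⟨p, q, rfl⟩ := Affine.CoordinateRing.exists_smul_basis_eq r
  rw [algebraMap_smul_basis]
  have hp (hp0 : p ≠ 0) := valuationAt_zero_aeval W hp0
  have hq (hq0 : q ≠ 0) : valuationAt W 0 (aeval (xFun W) q * yFun W) =
      WithZero.exp (2 * q.natDegree + 3 : ℤ) := by
    rw [map_mul, valuationAt_zero_aeval W hq0, valuationAt_zero_yFun, ← WithZero.exp_add]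
  have hq' (hq0 : q ≠ 0) : valuationAt W 0 (aeval (xFun W) q * yFun W -
      q.leadingCoeff • poleFun W (2 * q.natDegree + 3)) <
        WithZero.exp (2 * q.natDegree + 3 : ℤ) := by
    rw [poleFun_two_mul_add_three, ← smul_mul_assoc, ← sub_mul, map_mul, valuationAt_zero_yFun,
      WithZero.exp_add]
    exact mul_lt_mul_of_pos_right (valuationAt_zero_aeval_sub_lt q) WithZero.exp_pos
  have hp' : valuationAt W 0 (aeval (xFun W) p -
      p.leadingCoeff • poleFun W (2 * p.natDegree)) < WithZero.exp (2 * p.natDegree : ℤ) := by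
    rw [poleFun_two_mul]
    exact valuationAt_zero_aeval_sub_lt p
  by_cases h : valuationAt W 0 (aeval (xFun W) p) < valuationAt W 0 (aeval (xFun W) q * yFun W)
  · have hq0 : q ≠ 0 := by
      rintro rfl
      simp at h
    refine ⟨2 * q.natDegree + 3, by omega, ?_, q.leadingCoeff, ?_⟩
    · rw [Valuation.map_add_eq_of_lt_right _ h, hq hq0]
      push_cast
      rfl
    · rw [add_sub_assoc]
      push_cast
      exact Valuation.map_add_lt _ (by rwa [← hq hq0]) (hq' hq0)
  · have hp0 : p ≠ 0 := by
      rintro rfl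
      rw [map_zero, map_zero, zero_lt_iff, not_not, Valuation.zero_iff, mul_eq_zero,
        or_iff_left yFun_ne_zero] at h
      have hq0 : q ≠ 0 := by
        rintro rfl
        simp at hr
      have := valuationAt_zero_aeval W hq0
      rw [h, map_zero] at this
      exact WithZero.exp_ne_zero this.symm
    have hlt : valuationAt W 0 (aeval (xFun W) q * yFun W) < valuationAt W 0 (aeval (xFun W) p) := by
      refine lt_of_le_of_ne (not_lt.mp h) fun he => ?_
      by_cases hq0 : q = 0
      · rw [hq0, map_zero, zero_mul, map_zero, hp hp0] at he
        exact WithZero.exp_ne_zero he.symm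
      · rw [hp hp0, hq hq0, WithZero.exp_inj] at he
        omega
    refine ⟨2 * p.natDegree, by omega, ?_, p.leadingCoeff, ?_⟩
    · rw [Valuation.map_add_eq_of_lt_left _ hlt, hp hp0]
      push_cast
      rfl
    · rw [add_sub_right_comm]
      push_cast
      exact Valuation.map_add_lt _ (hp') (by rwa [← hp hp0])

/-- A function without poles is constant. -/
theorem eq_algebraMap_of_no_poles {f : W.FunctionField} (hf : ∀ P, valuationAt W P f ≤ 1) :
    ∃ c : K, f = algebraMap K _ c := by
  obtain ⟨r, rfl⟩ := exists_algebraMap_eq_of_regular fun P _ => hf P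
  by_cases hr : r = 0
  · exact ⟨0, by simp [hr]⟩
  obtain ⟨k, _, hk, c, hc⟩ := exists_leading_term hr
  have h0 := hf 0
  rw [hk, ← WithZero.exp_zero, WithZero.exp_le_exp] at h0
  obtain rfl : k = 0 := by omega
  have hpole : c • poleFun W 0 = algebraMap W.CoordinateRing W.FunctionField
      (algebraMap K W.CoordinateRing c) := by
    have := poleFun_two_mul (W := W) 0
    rw [mul_zero, pow_zero] at this
    rw [this, Algebra.smul_def, mul_one]
    rfl
  refine ⟨c, ?_⟩
  by_contra hne
  rw [hpole, ← map_sub] at hc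
  have hne' : r - algebraMap K W.CoordinateRing c ≠ 0 := by
    intro h
    rw [sub_eq_zero] at h
    exact hne (by rw [h]; rfl)
  rw [valuationAt_zero_algebraMap W hne', WithZero.exp_lt_exp] at hc
  omega

/-- The pole orders of the functions in a basis of `L(n.O)`. -/
def basisPoleOrder (j : ℕ) : ℕ := if j = 0 then 0 else j + 1

theorem basisPoleOrder_ne_one (j : ℕ) : basisPoleOrder j ≠ 1 := by
  rw [basisPoleOrder]
  split_ifs <;> omega

theorem basisPoleOrder_injective : Function.Injective basisPoleOrder := by
  intro i j h
  simp only [basisPoleOrder] at h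
  split_ifs at h <;> omega

theorem basisPoleOrder_le {j n : ℕ} (h : j < n) : basisPoleOrder j ≤ n := by
  rw [basisPoleOrder]
  split_ifs <;> omega

theorem exists_basisPoleOrder_eq {k n : ℕ} (hn : n ≠ 0) (hk : k ≠ 1) (hkn : k ≤ n) :
    ∃ j < n, basisPoleOrder j = k := by
  refine ⟨k - 1, by omega, ?_⟩
  rw [basisPoleOrder]
  split_ifs <;> omega

/-- Row weights and pole orders together give n² - 1, the pole order of g at O. -/
theorem sum_basisPoleOrder {n : ℕ} (hn : n ≠ 0) :
    ∑ j ∈ Finset.range n, (j + basisPoleOrder j) + 1 = n ^ 2 := by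
  induction n with
  | zero => exact absurd rfl hn
  | succ n ih =>
    rcases eq_or_ne n 0 with rfl | h
    · simp [basisPoleOrder]
    · rw [Finset.sum_range_succ, add_right_comm, ih h, basisPoleOrder, if_neg h]
      ring

variable (W) in
/-- The basis of `L(n.O)` consisting of monomials in `x` and `y`. -/
def monomialFamily (n : ℕ) (j : Fin n) : riemannRoch W n :=
  ⟨poleFun W (basisPoleOrder j), fun _ hP => poleFun_regular _ hP, by
    rw [valuationAt_zero_poleFun (basisPoleOrder_ne_one j), WithZero.exp_le_exp]
    exact_mod_cast basisPoleOrder_le j.2⟩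

variable (W) in
/-- The Wronskian of the monomial basis of `L(n.O)`. -/
def monomialWronskian (n : ℕ) : W.FunctionField :=
  wronskian W fun j => (monomialFamily W n j : W.FunctionField)

theorem prod_exp {ι : Type*} (s : Finset ι) (f : ι → ℤ) :
    ∏ i ∈ s, WithZero.exp (f i) = WithZero.exp (∑ i ∈ s, f i) := by
  classical
  induction s using Finset.induction_on with
  | empty => simp
  | insert i s hi ih => rw [Finset.prod_insert hi, Finset.sum_insert hi, ih, WithZero.exp_add]

theorem valuationAt_zero_monomialWronskian [CharZero K] {n : ℕ} (hn : n ≠ 0) :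
    valuationAt W 0 (monomialWronskian W n) = WithZero.exp ((n : ℤ) ^ 2 - 1) := by
  refine (valuationAt_zero_wronskian (m := fun j : Fin n => (basisPoleOrder j : ℤ))
    (fun i j h => Fin.ext (basisPoleOrder_injective (Nat.cast_injective h)))
    fun j => hasLeadingExponent_poleFun (basisPoleOrder_ne_one j)).trans ?_
  rw [← Finset.prod_mul_distrib]
  have h (j : Fin n) : WithZero.exp (j : ℤ) *
      valuationAt W 0 (poleFun W (basisPoleOrder j)) =
      WithZero.exp (((j : ℕ) + basisPoleOrder j : ℕ) : ℤ) := by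
    rw [valuationAt_zero_poleFun (basisPoleOrder_ne_one j), ← WithZero.exp_add]
    push_cast
    rfl
  have hsum := sum_basisPoleOrder hn
  rw [Finset.prod_congr rfl fun j _ => h j, prod_exp, ← Nat.cast_sum, WithZero.exp_inj,
    Fin.sum_univ_eq_sum_range (fun j => j + basisPoleOrder j)]
  have : ((∑ j ∈ Finset.range n, (j + basisPoleOrder j) + 1 : ℕ) : ℤ) = (n : ℤ) ^ 2 := by
    rw [hsum]
    push_cast
    rfl
  push_cast at this ⊢
  linarith

theorem monomialWronskian_ne_zero [CharZero K] {n : ℕ} (hn : n ≠ 0) :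
    monomialWronskian W n ≠ 0 := by
  rw [← Valuation.ne_zero_iff (valuationAt W 0), valuationAt_zero_monomialWronskian hn]
  exact WithZero.exp_ne_zero

theorem iterate_invDeriv_sum {n i : ℕ} (c : Fin n → K) (h : Fin n → W.FunctionField) :
    (invDeriv W)^[i] (∑ j, c j • h j) =
      ∑ j, (invDeriv W)^[i] (h j) * algebraMap K W.FunctionField (c j) := by
  induction i with
  | zero =>
    simp only [Function.iterate_zero, id_eq, Algebra.smul_def]
    exact Finset.sum_congr rfl fun j _ => mul_comm _ _
  | succ i ih =>
    rw [Function.iterate_succ_apply', ih, map_sum]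
    refine Finset.sum_congr rfl fun j _ => ?_
    rw [Derivation.leibniz, invDeriv_algebraMap, Function.iterate_succ_apply', smul_zero, zero_add,
      smul_eq_mul, mul_comm]

theorem wronskianMatrix_mulVec {n : ℕ} (h : Fin n → W.FunctionField) (c : Fin n → K) :
    (wronskianMatrix W h).mulVec (fun j => algebraMap K _ (c j)) =
      fun i : Fin n => (invDeriv W)^[i] (∑ j, c j • h j) := by
  funext i
  rw [iterate_invDeriv_sum]
  rfl

theorem linearIndependent_of_wronskian_ne_zero {n : ℕ} {h : Fin n → W.FunctionField}
    (hw : wronskian W h ≠ 0) : LinearIndependent K h := by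
  rw [Fintype.linearIndependent_iff]
  intro c hc i
  by_contra hi
  refine hw (Matrix.exists_mulVec_eq_zero_iff.mp ⟨fun j => algebraMap K _ (c j), ?_, ?_⟩)
  · intro h0
    exact hi ((_root_.map_eq_zero _).mp (congrFun h0 i))
  · rw [wronskianMatrix_mulVec, hc]
    funext i
    exact Function.iterate_fixed (map_zero _) _

theorem linearIndependent_monomialFamily [CharZero K] {n : ℕ} (hn : n ≠ 0) :
    LinearIndependent K (monomialFamily W n) :=
  LinearIndependent.of_comp (riemannRoch W n).subtype
    (linearIndependent_of_wronskian_ne_zero (monomialWronskian_ne_zero hn))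

/-- Induction on a strict bound for the pole order, subtracting the leading monomial each time. With
bound 0 only the zero function remains. -/
theorem span_monomialFamily {n : ℕ} (hn : n ≠ 0) :
    ⊤ ≤ Submodule.span K (Set.range (monomialFamily W n)) := by
  suffices H : ∀ (k : ℕ) (f : riemannRoch W n),
      valuationAt W 0 (f : W.FunctionField) < WithZero.exp (k : ℤ) →
        f ∈ Submodule.span K (Set.range (monomialFamily W n)) by
    intro f _
    refine H (n + 1) f (f.2.2.trans_lt ?_)
    rw [WithZero.exp_lt_exp]
    push_cast
    omega
  intro k
  induction k with
  | zero =>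
    intro f hf
    obtain ⟨r, hr⟩ := exists_algebraMap_eq_of_regular f.2.1
    by_cases hr0 : r = 0
    · rw [hr0, map_zero] at hr
      rw [show f = 0 from Subtype.ext hr.symm]
      exact zero_mem _
    · rw [← hr, valuationAt_zero_algebraMap W hr0, WithZero.exp_lt_exp] at hf
      omega
  | succ k ih =>
    intro f hf
    obtain ⟨r, hr⟩ := exists_algebraMap_eq_of_regular f.2.1
    by_cases hr0 : r = 0
    · rw [hr0, map_zero] at hr
      rw [show f = 0 from Subtype.ext hr.symm]
      exact zero_mem _
    · obtain ⟨l, hl1, hl, c, hc⟩ := exists_leading_term hr0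
      rw [hr] at hl hc
      have hln := f.2.2
      rw [hl, WithZero.exp_le_exp] at hln
      obtain ⟨j, hj, hjl⟩ := exists_basisPoleOrder_eq hn hl1 (by exact_mod_cast hln)
      have hmem : monomialFamily W n ⟨j, hj⟩ ∈ Submodule.span K (Set.range (monomialFamily W n)) :=
        Submodule.subset_span ⟨_, rfl⟩
      rw [← sub_add_cancel f (c • monomialFamily W n ⟨j, hj⟩)]
      refine add_mem (ih _ ?_) (Submodule.smul_mem _ c hmem)
      rw [hl, WithZero.exp_lt_exp] at hf
      have hlk : (l : ℤ) ≤ k := by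
        push_cast at hf
        omega
      refine lt_of_lt_of_le ?_ (WithZero.exp_le_exp.mpr hlk)
      rw [← hjl] at hc ⊢
      exact hc

variable (W) in
/-- The monomial basis of `L(n.O)`. -/
def monomialBasis [CharZero K] {n : ℕ} (hn : n ≠ 0) : Module.Basis (Fin n) K (riemannRoch W n) :=
  .mk (linearIndependent_monomialFamily hn) (span_monomialFamily hn)

end RiemannRoch

/-! ### Functions with an `n`-fold zero at a point of order dividing `n` -/

section Torsion

variable {K : Type u} [Field K] {W : Affine K} [W.IsElliptic] [IsAlgClosed K] [DecidableEq K]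

theorem eval₂_polynomial {S : Type*} [CommRing S] (ψ : K[X] →+* S) (b : S) :
    W.polynomial.eval₂ ψ b = b ^ 2 + ψ (C W.a₁ * X + C W.a₃) * b -
      ψ (X ^ 3 + C W.a₂ * X ^ 2 + C W.a₄ * X + C W.a₆) := by
  rw [Affine.polynomial, eval₂_sub, eval₂_add, eval₂_mul, eval₂_pow, eval₂_X, eval₂_C, eval₂_C]

variable (W) in
/-- The endomorphism of the coordinate ring induced by the negation map of the curve. -/
theorem exists_conj : ∃ σ : W.CoordinateRing →+* W.CoordinateRing,
    (∀ p q : K[X], σ (p • 1 + q • Affine.CoordinateRing.mk W Y) =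
      (p - q * (C W.a₁ * X + C W.a₃)) • 1 + (-q) • Affine.CoordinateRing.mk W Y) := by
  set y : W.CoordinateRing := AdjoinRoot.root W.polynomial
  let ψ : K[X] →+* W.CoordinateRing := AdjoinRoot.of W.polynomial
  have h0 : W.polynomial.eval₂ ψ y = 0 := AdjoinRoot.eval₂_root W.polynomial
  -- This is the other root of the Weierstrass equation, a quadratic in y.
  have hroot : W.polynomial.eval₂ ψ (-y - ψ (C W.a₁ * X + C W.a₃)) = 0 := by
    rw [eval₂_polynomial] at h0 ⊢
    linear_combination h0
  let σ : W.CoordinateRing →+* W.CoordinateRing := AdjoinRoot.lift ψ _ hroot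
  refine ⟨σ, fun p q => ?_⟩
  have h1 (p : K[X]) : σ (ψ p) = ψ p := AdjoinRoot.lift_of hroot
  have h2 : σ y = -y - ψ (C W.a₁ * X + C W.a₃) := AdjoinRoot.lift_root hroot
  have hsmul (p : K[X]) (z : W.CoordinateRing) : p • z = ψ p * z :=
    Affine.CoordinateRing.smul p z
  rw [hsmul, hsmul, hsmul, hsmul, mul_one, mul_one, map_add, map_mul, h1, h1,
    show σ (Affine.CoordinateRing.mk W Y) = _ from h2, map_sub, map_mul, map_neg,
    show Affine.CoordinateRing.mk W Y = y from rfl]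
  ring

/-- Conjugation carries the ideal of P to that of -P, and the product of these two ideals is
generated by x - x(P). -/
theorem span_mul_conj {x y : K} (h : W.Nonsingular x y) {n : ℕ} {f : W.CoordinateRing}
    {σ : W.CoordinateRing →+* W.CoordinateRing}
    (hσ : ∀ p q : K[X], σ (p • 1 + q • Affine.CoordinateRing.mk W Y) =
      (p - q * (C W.a₁ * X + C W.a₃)) • 1 + (-q) • Affine.CoordinateRing.mk W Y)
    (hf : Affine.CoordinateRing.XYIdeal W x (C y) ^ n = Ideal.span {f}) :
    Ideal.span {f * σ f} = Ideal.span {Affine.CoordinateRing.XClass W x ^ n} := by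
  let ψ : K[X] →+* W.CoordinateRing := AdjoinRoot.of W.polynomial
  set t : W.CoordinateRing := AdjoinRoot.root W.polynomial
  have hsmul (p : K[X]) (z : W.CoordinateRing) : p • z = ψ p * z :=
    Affine.CoordinateRing.smul p z
  have hXC : Affine.CoordinateRing.XClass W x = ψ (X - C x) := rfl
  have hYC (c : K) : Affine.CoordinateRing.YClass W (C c) = t - ψ (C c) :=
    map_sub (Affine.CoordinateRing.mk W) _ _
  have hX : σ (Affine.CoordinateRing.XClass W x) = Affine.CoordinateRing.XClass W x := by
    have := hσ (X - C x) 0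
    rwa [zero_smul, add_zero, neg_zero, zero_mul, sub_zero, zero_smul, add_zero, hsmul, mul_one]
      at this
  have hY : σ (Affine.CoordinateRing.YClass W (C y)) =
      -Affine.CoordinateRing.YClass W (C (W.negY x y)) +
        Affine.CoordinateRing.XClass W x * (-ψ (C W.a₁)) := by
    have := hσ (-C y) 1
    rw [hsmul, hsmul, hsmul, hsmul, show Affine.CoordinateRing.mk W Y = t from rfl] at this
    have e : Affine.CoordinateRing.YClass W (C y) = ψ (-C y) * 1 + ψ 1 * t := by
      rw [hYC, map_neg, map_one]
      ring
    rw [e, this, hYC, hXC, Affine.negY]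
    simp only [map_sub, map_neg, map_mul, map_add, map_one]
    ring
  have hmap : (Affine.CoordinateRing.XYIdeal W x (C y)).map σ =
      Affine.CoordinateRing.XYIdeal W x (C (W.negY x y)) := by
    rw [Affine.CoordinateRing.XYIdeal, Ideal.map_span, Set.image_pair, hX, hY,
      Ideal.span_pair_add_left_mul, Affine.CoordinateRing.XYIdeal, Ideal.span_insert,
      Ideal.span_singleton_neg, ← Ideal.span_insert]
  have hmapn := congrArg (Ideal.map σ) hf
  rw [Ideal.map_pow, hmap, Ideal.map_span, Set.image_singleton] at hmapn
  rw [← Ideal.span_singleton_mul_span_singleton, ← hf, ← hmapn, ← mul_pow, mul_comm,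
    Affine.CoordinateRing.XYIdeal_neg_mul h, Affine.CoordinateRing.XIdeal, Ideal.span_singleton_pow]

/-- As nP = O, the n-th power of the ideal of P is trivial in the class group; its generator f has
the n-fold zero. Conjugation preserves pole orders and f times its conjugate is associated to (x -
x(P))^n, of pole order 2n, so f has pole order n. -/
theorem exists_riemannRoch_of_nsmul_eq_zero {P : W.Point} (hP : P ≠ 0) {n : ℕ} (hn : n • P = 0) :
    ∃ f : riemannRoch W n, f ≠ 0 ∧ valuationAt W P (f : W.FunctionField) ≤ WithZero.exp (-n : ℤ) := by
  match P with
  | .zero => exact absurd rfl hP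
  | .some x y h =>
    have hcl : ClassGroup.mk W.FunctionField (Affine.CoordinateRing.XYIdeal' h ^ n) = 1 := by
      have := congrArg (Affine.Point.toClass (W := W)) hn
      rw [map_nsmul, map_zero, Affine.Point.toClass_some] at this
      rw [map_pow]
      exact this
    have hI : ((Affine.CoordinateRing.XYIdeal' h ^ n : (FractionalIdeal W.CoordinateRing⁰
        W.FunctionField)ˣ) : FractionalIdeal W.CoordinateRing⁰ W.FunctionField) =
        ((Affine.CoordinateRing.XYIdeal W x (C y) ^ n : Ideal W.CoordinateRing) : _) := by
      rw [Units.val_pow_eq_pow_val, Affine.CoordinateRing.XYIdeal'_eq, FractionalIdeal.coeIdeal_pow]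
    obtain ⟨f, hf0, hf⟩ := (ClassGroup.mk_eq_one_of_coe_ideal hI).mp hcl
    have hpole : poleOrder W f = n := by
      obtain ⟨σ, hσ⟩ := exists_conj W
      have hconj : poleOrder W (σ f) = poleOrder W f := by
        obtain ⟨p, q, rfl⟩ := Affine.CoordinateRing.exists_smul_basis_eq f
        rw [hσ, poleOrder, poleOrder, Affine.CoordinateRing.norm_smul_basis,
          Affine.CoordinateRing.norm_smul_basis]
        congr 1
        ring
      have hmul {a b : W.CoordinateRing} (ha : a ≠ 0) (hb : b ≠ 0) :
          poleOrder W (a * b) = poleOrder W a + poleOrder W b := by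
        rw [poleOrder, map_mul, natDegree_mul (norm_ne_zero W ha) (norm_ne_zero W hb)]
        rfl
      have hassoc := Ideal.span_singleton_eq_span_singleton.mp (span_mul_conj h hσ hf)
      have hXn : Affine.CoordinateRing.XClass W x ^ n ≠ 0 :=
        pow_ne_zero n (Affine.CoordinateRing.XClass_ne_zero x)
      have hprod : f * σ f ≠ 0 := fun h0 => hXn (hassoc.eq_zero_iff.mp h0)
      have hnorm : poleOrder W (f * σ f) = poleOrder W (Affine.CoordinateRing.XClass W x ^ n) :=
        natDegree_eq_of_degree_eq (degree_eq_degree_of_associated (hassoc.map (Algebra.norm K[X])))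
      have hX : Algebra.norm K[X] (Affine.CoordinateRing.XClass W x) = (X - C x) ^ 2 := by
        have := Affine.CoordinateRing.norm_smul_basis (W' := W) (X - C x) 0
        rw [zero_smul, add_zero, Affine.CoordinateRing.smul, mul_one] at this
        rw [Affine.CoordinateRing.XClass, this]
        ring
      rw [hmul hf0 (right_ne_zero_of_mul hprod), hconj, poleOrder, poleOrder, map_pow, hX, ← pow_mul,
        natDegree_pow, natDegree_X_sub_C] at hnorm
      change (Algebra.norm K[X] f).natDegree = n
      omega
    refine ⟨⟨algebraMap _ _ f, fun P hP => valuationAt_algebraMap_coordinateRing_le_one W hP f, ?_⟩,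
      ?_, ?_⟩
    · rw [valuationAt_zero_algebraMap W hf0, hpole]
    · intro h0
      exact hf0 (IsFractionRing.injective W.CoordinateRing W.FunctionField
        ((congrArg Subtype.val h0).trans (map_zero _).symm))
    · change (affinePlace W h).valuation W.FunctionField (algebraMap _ _ f) ≤ _
      rw [IsDedekindDomain.HeightOneSpectrum.valuation_of_algebraMap,
        IsDedekindDomain.HeightOneSpectrum.intValuation_le_pow_iff_mem]
      change f ∈ Affine.CoordinateRing.XYIdeal W x (C y) ^ n
      rw [hf]
      exact Ideal.mem_span_singleton_self f

theorem valuationAt_iterate_invDeriv_le (P : W.Point) (f : W.FunctionField) (i : ℕ) :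
    valuationAt W P ((invDeriv W)^[i] f) ≤ WithZero.exp (i : ℤ) * valuationAt W P f := by
  induction i with
  | zero => simp
  | succ i ih =>
    rw [Function.iterate_succ_apply', Nat.cast_succ, add_comm (i : ℤ), WithZero.exp_add, mul_assoc]
    refine (valuationAt_invDeriv_le W P _).trans ?_
    gcongr

theorem valuationAt_iterate_invDeriv_le_one {P : W.Point} (hP : P ≠ 0) (r : W.CoordinateRing)
    (i : ℕ) : valuationAt W P ((invDeriv W)^[i] (algebraMap _ _ r)) ≤ 1 := by
  induction i generalizing r with
  | zero => exact valuationAt_algebraMap_coordinateRing_le_one W hP r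
  | succ i ih =>
    obtain ⟨s, hs⟩ := exists_algebraMap_eq_invDeriv W r
    rw [Function.iterate_succ_apply, ← hs]
    exact ih s

theorem valuationAt_wronskianMatrix_le_one {P : W.Point} (hP : P ≠ 0) {n m : ℕ}
    (h : Fin n → riemannRoch W m) (i j : Fin n) :
    valuationAt W P (wronskianMatrix W (fun j => (h j : W.FunctionField)) i j) ≤ 1 := by
  obtain ⟨r, hr⟩ := exists_algebraMap_eq_of_regular (h j).2.1
  rw [wronskianMatrix, Matrix.of_apply, ← hr]
  exact valuationAt_iterate_invDeriv_le_one hP r i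

theorem valuationAt_wronskian_le_one {P : W.Point} (hP : P ≠ 0) {n m : ℕ}
    (h : Fin n → riemannRoch W m) :
    valuationAt W P (wronskian W fun j => (h j : W.FunctionField)) ≤ 1 :=
  valuation_det_le_one _ (valuationAt_wronskianMatrix_le_one hP h)

/-- The Wronskian of a basis of `L(n.O)` vanishes at the non-zero `n`-torsion points. -/
theorem valuationAt_monomialWronskian_lt_one [CharZero K] {P : W.Point} (hP : P ≠ 0) {n : ℕ}
    (hn : n ≠ 0) (hnP : n • P = 0) : valuationAt W P (monomialWronskian W n) < 1 := by
  obtain ⟨f, hf0, hf⟩ := exists_riemannRoch_of_nsmul_eq_zero hP hnP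
  set b := monomialBasis W hn
  have hb (j : Fin n) : b j = monomialFamily W n j := Module.Basis.mk_apply _ _ j
  set c : Fin n → K := fun j => b.repr f j
  have hfc : (f : W.FunctionField) = ∑ j, c j • (monomialFamily W n j : W.FunctionField) := by
    have := congrArg Subtype.val (b.sum_repr f)
    rw [← this, Submodule.coe_sum]
    refine Finset.sum_congr rfl fun j _ => ?_
    rw [Submodule.coe_smul, hb]
  obtain ⟨j, hj⟩ : ∃ j, c j ≠ 0 := by
    by_contra! hc
    refine hf0 (Subtype.ext ?_)
    rw [hfc]
    simp [hc]
  set A := wronskianMatrix W fun j => (monomialFamily W n j : W.FunctionField)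
  have hA := valuationAt_wronskianMatrix_le_one hP (monomialFamily W n)
  have hAc : A.mulVec (fun j => algebraMap K _ (c j)) = fun i : Fin n => (invDeriv W)^[i] f := by
    rw [wronskianMatrix_mulVec, hfc]
  -- Cramer's rule: the Wronskian times a non-zero coordinate of f is a regular combination of the
  -- derivatives D^i f.
  have hdet : A.det * algebraMap K _ (c j) =
      ∑ i : Fin n, A.adjugate j i * (invDeriv W)^[i] f := by
    have h1 : A.adjugate.mulVec (A.mulVec fun j => algebraMap K _ (c j)) j =
        A.det * algebraMap K _ (c j) := by
      rw [Matrix.mulVec_mulVec, Matrix.adjugate_mul, Matrix.smul_mulVec, Matrix.one_mulVec]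
      rfl
    rw [← h1, hAc]
    rfl
  have hadj (i : Fin n) : valuationAt W P (A.adjugate j i) ≤ 1 := by
    rw [Matrix.adjugate_apply]
    refine valuation_det_le_one _ fun k l => ?_
    rw [Matrix.updateRow_apply, Pi.single_apply]
    split_ifs
    · simp
    · simp
    · exact hA k l
  have hv : valuationAt W P (A.det * algebraMap K _ (c j)) < 1 := by
    rw [hdet]
    refine Valuation.map_sum_lt _ one_ne_zero fun i _ => ?_
    rw [map_mul]
    refine (mul_le_of_le_one_left' (hadj i)).trans_lt ?_
    refine ((valuationAt_iterate_invDeriv_le P _ i).trans (mul_le_mul_right hf _)).trans_lt ?_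
    -- As i < n, the derivative D^i f still vanishes at P.
    rw [← WithZero.exp_add, ← WithZero.exp_zero, WithZero.exp_lt_exp]
    have := i.2
    omega
  rwa [map_mul, valuationAt_algebraMap_eq_one W P hj, mul_one] at hv

end Torsion

/-! ### Transformation of the Wronskian -/

section Transformation

variable {K : Type u} [Field K] {W : Affine K} [W.IsElliptic] [IsAlgClosed K] [DecidableEq K]

theorem wronskian_translate {n : ℕ} (T : W.Point) (h : Fin n → W.FunctionField) :
    wronskian W (fun j => translate W T (h j)) = translate W T (wronskian W h) := by
  rw [wronskian, wronskian, AlgHom.map_det]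
  congr 1
  ext i j
  have hcomm : Function.Commute (translate W T) (invDeriv W) :=
    fun f => (invDeriv_translate W T f).symm
  exact (hcomm.iterate_right i (h j)).symm

theorem wronskian_sum_smul {n : ℕ} (A : Matrix (Fin n) (Fin n) K) (h : Fin n → W.FunctionField) :
    wronskian W (fun j => ∑ k, A k j • h k) = algebraMap K _ A.det * wronskian W h := by
  have : wronskianMatrix W (fun j => ∑ k, A k j • h k) =
      wronskianMatrix W h * A.map (algebraMap K W.FunctionField) := by
    ext i j
    exact iterate_invDeriv_sum (fun k => A k j) h
  rw [wronskian, this, Matrix.det_mul, mul_comm, wronskian, RingHom.map_det]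
  rfl

/-- The coefficients in the Leibniz rule for iterated derivatives. -/
def leibnizCoeff (f : W.FunctionField) : ℕ → ℕ → W.FunctionField
  | 0, 0 => f
  | 0, _ + 1 => 0
  | i + 1, 0 => invDeriv W (leibnizCoeff f i 0)
  | i + 1, l + 1 => invDeriv W (leibnizCoeff f i (l + 1)) + leibnizCoeff f i l

theorem leibnizCoeff_eq_zero (f : W.FunctionField) {i l : ℕ} (h : i < l) :
    leibnizCoeff f i l = 0 := by
  induction i generalizing l with
  | zero =>
    obtain ⟨l, rfl⟩ := Nat.exists_eq_succ_of_ne_zero h.ne'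
    rfl
  | succ i ih =>
    obtain ⟨l, rfl⟩ := Nat.exists_eq_succ_of_ne_zero (Nat.ne_zero_of_lt h)
    rw [leibnizCoeff, ih (by omega), ih (by omega), map_zero, add_zero]

theorem leibnizCoeff_self (f : W.FunctionField) (i : ℕ) : leibnizCoeff f i i = f := by
  induction i with
  | zero => rfl
  | succ i ih => rw [leibnizCoeff, leibnizCoeff_eq_zero f (Nat.lt_succ_self i), map_zero, zero_add,
      ih]

theorem iterate_invDeriv_mul (f h : W.FunctionField) {i n : ℕ} (hi : i < n) :
    (invDeriv W)^[i] (f * h) =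
      ∑ l ∈ Finset.range n, leibnizCoeff f i l * (invDeriv W)^[l] h := by
  induction i with
  | zero =>
    rw [Finset.sum_eq_single_of_mem 0 (Finset.mem_range.mpr hi)]
    · rfl
    · intro l _ hl
      rw [leibnizCoeff_eq_zero f (Nat.pos_of_ne_zero hl), zero_mul]
  | succ i ih =>
    obtain ⟨n, rfl⟩ := Nat.exists_eq_succ_of_ne_zero (Nat.ne_zero_of_lt hi)
    rw [Function.iterate_succ_apply', ih (by omega), map_sum]
    simp only [Derivation.leibniz, smul_eq_mul, ← Function.iterate_succ_apply' (f := invDeriv W)]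
    rw [Finset.sum_add_distrib, Finset.sum_range_succ, leibnizCoeff_eq_zero f (by omega : i < n),
      zero_mul, add_zero, Finset.sum_range_succ' _ n, Finset.sum_range_succ' _ n, ← add_assoc,
      ← Finset.sum_add_distrib]
    congr 1
    · refine Finset.sum_congr rfl fun l _ => ?_
      rw [leibnizCoeff]
      ring
    · rw [leibnizCoeff, mul_comm]

/-- By the Leibniz rule the matrix is multiplied on the left by a lower triangular matrix with f on
the diagonal; the entries below it are irrelevant. -/
theorem wronskian_mul {n : ℕ} (f : W.FunctionField) (h : Fin n → W.FunctionField) :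
    wronskian W (fun j => f * h j) = f ^ n * wronskian W h := by
  let L : Matrix (Fin n) (Fin n) W.FunctionField := Matrix.of fun i l => leibnizCoeff f i l
  have : wronskianMatrix W (fun j => f * h j) = L * wronskianMatrix W h := by
    ext i j
    rw [Matrix.mul_apply]
    exact (iterate_invDeriv_mul f (h j) i.2).trans (Finset.sum_range _)
  have hL : L.det = f ^ n := by
    rw [Matrix.det_of_isLowerTriangular L fun i j hij => leibnizCoeff_eq_zero f hij]
    simp [L, leibnizCoeff_self]
  rw [wronskian, this, Matrix.det_mul, hL, wronskian]

theorem map_constPoint (φ : W.FunctionField →ₐ[K] W.FunctionField) (T : W.Point) :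
    Affine.Point.map (W' := W) φ (constPoint W T) = constPoint W T := by
  match T with
  | .zero => rfl
  | .some x y h =>
    refine (Affine.Point.some.injEq _ _ _ _ _ _).mpr ⟨?_, ?_⟩
    · exact φ.commutes x
    · exact φ.commutes y

/-- The composite fixes the generic point, that is, x and y, hence the whole function field. -/
theorem translate_neg_translate (T : W.Point) (f : W.FunctionField) :
    translate W (-T) (translate W T f) = f := by
  have h : (translate W (-T)).comp (translate W T) = AlgHom.id K W.FunctionField := by
    have hmap : Affine.Point.map (W' := W) ((translate W (-T)).comp (translate W T))
        (genericPoint W) = genericPoint W := by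
      rw [← Affine.Point.map_map, map_translate_genericPoint, map_add, map_translate_genericPoint,
        map_neg, map_constPoint, neg_add_cancel_right]
    have := Affine.Point.some.inj hmap
    exact algHom_functionField_ext W this.1 this.2
  exact DFunLike.congr_fun h f

/-- The elements `(f, T)` of the Heisenberg group satisfy `fⁿ · τ_T^* w = w` for the Wronskian `w`
of the monomial basis of `L(n.O)`. -/
theorem pow_mul_translate_monomialWronskian [CharZero K] {n : ℕ} (hn : n ≠ 0)
    {p : W.FunctionFieldˣ × W.Point} (hp : p ∈ heisenbergGroup W n) :
    (p.1 : W.FunctionField) ^ n * translate W p.2 (monomialWronskian W n) =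
      monomialWronskian W n := by
  obtain ⟨_, M, ⟨B, hB, rfl⟩, hdet⟩ := hp
  let b := monomialBasis W hn
  have : Module.Finite K (riemannRoch W n) := .of_basis b
  -- A map and its transpose have the same determinant, so the condition on V_n becomes one on h ↦ f
  -- · τ_T^* h.
  rw [LinearMap.det_dualMap, ← LinearMap.det_toMatrix b] at hdet
  have hb (j : Fin n) : b j = monomialFamily W n j := Module.Basis.mk_apply _ _ j
  have hBb (j : Fin n) : (p.1 : W.FunctionField) *
      translate W p.2 (monomialFamily W n j : W.FunctionField) =
      ∑ k, LinearMap.toMatrix b b B k j • (monomialFamily W n k : W.FunctionField) := by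
    rw [← hB, ← hb j]
    have := congrArg Subtype.val (b.sum_repr (B (b j)))
    rw [← this, Submodule.coe_sum]
    refine Finset.sum_congr rfl fun k _ => ?_
    rw [LinearMap.toMatrix_apply, ← hb k]
    rfl
  rw [monomialWronskian, ← wronskian_translate, ← wronskian_mul]
  simp only [hBb]
  rw [wronskian_sum_smul, hdet, map_one, one_mul]

/-- A function with divisor `[n]^* O - n². O` is a multiple of the Wronskian of a basis
of `L(n.O)`. -/
theorem exists_monomialWronskian_eq_mul [CharZero K] {n : ℕ} (hn : n ≠ 0) {g : W.FunctionField}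
    (hg : g ≠ 0) (hdiv : divisor W g = mulPullback W n - multO W ((n : ℤ) ^ 2)) :
    ∃ c : K, c ≠ 0 ∧ monomialWronskian W n = algebraMap K _ c * g := by
  have hw := monomialWronskian_ne_zero (W := W) hn
  -- One inequality at every point suffices, since a quotient without poles is already constant.
  have hle (P : W.Point) : valuationAt W P (monomialWronskian W n) ≤ valuationAt W P g := by
    have hP := congrFun hdiv P
    rw [mulPullback_eq hn, Pi.sub_apply, multO, divisor] at hP
    rw [exp_log_valuationAt W P hg, hP]
    by_cases h0 : P = 0
    · subst h0
      rw [valuationAt_zero_monomialWronskian hn, WithZero.exp_le_exp, if_pos (smul_zero n),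
        Pi.single_eq_same]
      omega
    · rw [Pi.single_eq_of_ne h0, sub_zero]
      split_ifs with hnP
      · have := valuationAt_monomialWronskian_lt_one h0 hn hnP
        rw [exp_log_valuationAt W P hw, ← WithZero.exp_zero, WithZero.exp_lt_exp] at this
        rw [exp_log_valuationAt W P hw, WithZero.exp_le_exp]
        omega
      · rw [neg_zero, WithZero.exp_zero]
        exact valuationAt_wronskian_le_one h0 _
  obtain ⟨c, hc⟩ := eq_algebraMap_of_no_poles (f := monomialWronskian W n / g) fun P => by
    rw [map_div₀]
    exact (div_le_one₀ (valuationAt_pos P hg)).mpr (hle P)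
  rw [div_eq_iff hg] at hc
  refine ⟨c, ?_, hc⟩
  rintro rfl
  rw [map_zero, zero_mul] at hc
  exact hw hc

end Transformation

end EllipticTheta

end

/-! ### The invariance of g^N. -/

open EllipticTheta in
theorem mainTheorem7 {K : Type*} [Field K] [CharZero K] [IsAlgClosed K] [DecidableEq K]
    (E : WeierstrassCurve.Affine K) [E.IsElliptic] (n N : ℕ) (hn : 2 ≤ n) (hN : 1 ≤ N)
    (g : E.FunctionField) (hg : g ≠ 0)
    (hdiv : EllipticTheta.divisor E g =
      EllipticTheta.mulPullback E n - EllipticTheta.multO E ((n : ℤ) ^ 2)) :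
    g ^ N ∈ EllipticTheta.riemannRoch E (n ^ 2 * N) ∧
      ∀ p ∈ EllipticTheta.heisenbergGroup E n,
        EllipticTheta.thetaAct E (n * N) p (g ^ N) = g ^ N := by
  have hn0 : n ≠ 0 := by omega
  obtain ⟨c, hc0, hc⟩ := exists_monomialWronskian_eq_mul hn0 hg hdiv
  have hval (P : E.Point) : valuationAt E P g = valuationAt E P (monomialWronskian E n) := by
    rw [hc, map_mul, valuationAt_algebraMap_eq_one E P hc0, one_mul]
  refine ⟨⟨fun P hP => ?_, ?_⟩, fun p hp => ?_⟩
  · rw [map_pow, hval]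
    exact pow_le_one' (valuationAt_wronskian_le_one hP _) N
  · rw [map_pow, hval, valuationAt_zero_monomialWronskian hn0, ← WithZero.exp_nsmul,
      WithZero.exp_le_exp, nsmul_eq_mul]
    push_cast
    -- The pole order N(n² - 1) is at most n²N.
    nlinarith
  · have hinv := pow_mul_translate_monomialWronskian hn0 hp
    have hf : (p.1 : E.FunctionField) ≠ 0 := p.1.ne_zero
    have hc1 : algebraMap K E.FunctionField c ≠ 0 := (_root_.map_ne_zero _).mpr hc0
    rw [hc, map_mul, AlgHom.commutes, mul_left_comm] at hinv
    -- The constant c is fixed by translation and cancels from the relation for the Wronskian.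
    have hτ : translate E p.2 g = g / (p.1 : E.FunctionField) ^ n := by
      rw [eq_div_iff (pow_ne_zero n hf), mul_comm]
      exact mul_left_cancel₀ hc1 hinv
    rw [thetaAct, pow_mul, ← div_pow, ← hτ, ← map_pow, translate_neg_translate]
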